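/- **Notation.** All Hilbert spaces are complex, $\mathbf L(\mathfrak H_1,\mathfrak H_2)$ denotes the bounded operators, $\mathbb D$ the open unit disk and $P_{\mathfrak L}$ the orthogonal projection onto a closed subspace $\mathfrak L$. For a contraction $T$ put $D_T=(I-T^*T)^{1/2}$, $D_{T^*}=(I-TT^*)^{1/2}$, $\mathfrak D_T=\overline{\mathrm{ran}}\,D_T$, $\mathfrak D_{T^*}=\overline{\mathrm{ran}}\,D_{T^*}$. For a bounded operator $S$, $S^{-1}$ denotes its Moore–Penrose pseudo-inverse: the operator with domain $\mathrm{ran}\,S\oplus(\mathrm{ran}\,S)^\perp$ that inverts $S{\upharpoonright}(\ker S)^\perp$ and vanishes on $(\mathrm{ran}\,S)^\perp$. The Schur class $\mathbf S(\mathfrak M,\mathfrak N)$ is the set of holomorphic $\Theta:\mathbb D\to\mathbf L(\mathfrak M,\mathfrak N)$ with $\|\Theta(\lambda)\|\le1$. The Möbius parameter of $\Theta\in\mathbf S(\mathfrak M,\mathfrak N)$ is the function $Z\in\mathbf S(\mathfrak D_{\Theta(0)},\mathfrak D_{\Theta(0)^*})$ with $$\Theta(\lambda)=\Theta(0)+D_{\Theta(0)^*}Z(\lambda)\bigl(I+\Theta(0)^*Z(\lambda)\bigr)^{-1}D_{\Theta(0)},\qquad\lambda\in\mathbb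 D,$$ and the first Schur iterate of $\Theta$ is $\Theta_1(\lambda)=Z(\lambda)/\lambda\in\mathbf S(\mathfrak D_{\Theta(0)},\mathfrak D_{\Theta(0)^*})$. A discrete-time system $\tau=\left\{\begin{bmatrix}D&C\\B&A\end{bmatrix};\mathfrak M,\mathfrak N,\mathfrak H\right\}$ consists of bounded operators $D:\mathfrak M\to\mathfrak N$, $C:\mathfrak H\to\mathfrak N$, $B:\mathfrak M\to\mathfrak H$, $A:\mathfrak H\to\mathfrak H$. It is conservative if its block operator $\mathfrak M\oplus\mathfrak H\to\mathfrak N\oplus\mathfrak H$ is unitary, and simple if the ranges of all $A^nB$ and $A^{*n}C^*$, $n\ge0$, span a dense subspace of $\mathfrak H$. Its transfer function is $D+\lambda C(I-\lambda A)^{-1}B$, $\lambda\in\mathbb D$. **Theorem.** Let $\Theta\in\mathbf S(\mathfrak M,\mathfrak N)$, $\Gamma_0=\Theta(0)$, and let $$\tau=\left\{\begin{bmatrix}\Gamma_0&C\\B&A\end{bmatrix};\mathfrak M,\mathfrak N,\mathfrak H\right\}$$ be a simple conservative system with transfer function $\Theta$. Then the first Schur iterate $\Theta_1$ of $\Theta$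 exists; the products $D_{\Gamma_0^*}^{-1}C\in\mathbf L(\mathfrak H,\mathfrak D_{\Gamma_0^*})$, $D_{A^*}^{-1}B\in\mathbf L(\mathfrak M,\mathfrak H)$ and $D_{\Gamma_0}^{-1}B^*\in\mathbf L(\mathfrak H,\mathfrak D_{\Gamma_0})$ are everywhere defined bounded operators; and $AP_{\ker D_A}D_{A^*}^{-1}B$ maps $\mathfrak D_{\Gamma_0}$ into $\ker D_{A^*}$. The system $$\nu=\left\{\begin{bmatrix}0&D_{\Gamma_0^*}^{-1}C\\D_{A^*}^{-1}B&AP_{\ker D_A}\end{bmatrix};\mathfrak D_{\Gamma_0},\mathfrak D_{\Gamma_0^*},\mathfrak H\right\}$$ is simple and conservative with transfer function $\lambda\Theta_1(\lambda)$, and the systems $$\zeta_1=\left\{\begin{bmatrix}D_{\Gamma_0^*}^{-1}C(D_{\Gamma_0}^{-1}B^*)^*&D_{\Gamma_0^*}^{-1}C{\upharpoonright}\ker D_{A^*}\\AP_{\ker D_A}D_{A^*}^{-1}B&P_{\ker D_{A^*}}A{\upharpoonright}\ker D_{A^*}\end{bmatrix};\mathfrak D_{\Gamma_0},\mathfrak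 D_{\Gamma_0^*},\ker D_{A^*}\right\},$$ $$\zeta_2=\left\{\begin{bmatrix}D_{\Gamma_0^*}^{-1}C(D_{\Gamma_0}^{-1}B^*)^*&D_{\Gamma_0^*}^{-1}CA{\upharpoonright}\ker D_A\\P_{\ker D_A}D_{A^*}^{-1}B&P_{\ker D_A}A{\upharpoonright}\ker D_A\end{bmatrix};\mathfrak D_{\Gamma_0},\mathfrak D_{\Gamma_0^*},\ker D_A\right\}$$ are simple and conservative with transfer function $\Theta_1(\lambda)$. (In $\nu,\zeta_1,\zeta_2$ the operator $D_{A^*}^{-1}B$ is restricted to $\mathfrak D_{\Gamma_0}$.) -/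

import Mathlib

open scoped InnerProductSpace

noncomputable section

namespace SchurRealization

variable {E F G : Type*}
  [NormedAddCommGroup E] [InnerProductSpace ℂ E] [CompleteSpace E]
  [NormedAddCommGroup F] [InnerProductSpace ℂ F] [CompleteSpace F]
  [NormedAddCommGroup G] [InnerProductSpace ℂ G] [CompleteSpace G]

/-- The adjoint `T* : F → E` of a bounded operator `T : E → F`. -/
abbrev adj (T : E →L[ℂ] F) : F →L[ℂ] E := ContinuousLinearMap.adjoint T

/-! ### Defect operators and defect subspaces -/

/-- The defect operator `D_T = (I - T* T)^{1/2}` of a contraction `T` (nonnegative square root). -/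
def defectOp (T : E →L[ℂ] F) : E →L[ℂ] E := CFC.sqrt (1 - adj T ∘L T)

/-- The defect subspace `𝔇_T`, the closure of the range of `D_T`. -/
abbrev defectSpace (T : E →L[ℂ] F) : Submodule ℂ E :=
  (LinearMap.range (defectOp T).toLinearMap).topologicalClosure

/-- The subspace `ker D_T`. -/
abbrev defectKer (T : E →L[ℂ] F) : Submodule ℂ E :=
  LinearMap.ker (defectOp T).toLinearMap

/-- `D_T` regarded as an operator from `E` to `𝔇_T`. -/
def defectCo (T : E →L[ℂ] F) : E →L[ℂ] defectSpace T :=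
  (defectOp T).codRestrict (defectSpace T)
    (fun x => Submodule.le_topologicalClosure _ (LinearMap.mem_range_self _ x))

/-- The adjoint `T*` regarded as an operator from `𝔇_{T*}` to `𝔇_T`. For a contraction `T` the
operator `T*` maps `𝔇_{T*}` into `𝔇_T` (see `coe_adjDefect`), so that the projection onto `𝔇_T`
only adjusts the codomain. -/
def adjDefect (T : E →L[ℂ] F) : defectSpace (adj T) →L[ℂ] defectSpace T :=
  (defectSpace T).orthogonalProjectionOnto ∘L adj T ∘L (defectSpace (adj T)).subtypeL

theorem one_sub_adj_comp_nonneg (T : E →L[ℂ] F) (hT : ‖T‖ ≤ 1) : 0 ≤ 1 - adj T ∘L T := by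
  rw [ContinuousLinearMap.nonneg_iff_isPositive, ContinuousLinearMap.isPositive_iff_complex]
  intro x
  have h1 : ⟪(1 - adj T ∘L T) x, x⟫_ℂ = ((‖x‖ ^ 2 - ‖T x‖ ^ 2 : ℝ) : ℂ) := by
    simp [ContinuousLinearMap.adjoint_inner_left, inner_self_eq_norm_sq_to_K]
  have h2 : ‖T x‖ ≤ ‖x‖ := by
    simpa using T.le_of_opNorm_le hT x
  rw [h1]
  refine ⟨by rw [RCLike.re_eq_complex_re, Complex.ofReal_re], ?_⟩
  have : ‖T x‖ ^ 2 ≤ ‖x‖ ^ 2 := by gcongr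
  rw [RCLike.re_eq_complex_re, Complex.ofReal_re]
  linarith

theorem defectOp_comp_self (T : E →L[ℂ] F) (hT : ‖T‖ ≤ 1) :
    defectOp T * defectOp T = 1 - adj T ∘L T :=
  CFC.sqrt_mul_sqrt_self _ (one_sub_adj_comp_nonneg T hT)

theorem adj_defectOp (T : E →L[ℂ] F) : adj (defectOp T) = defectOp T := by
  have h : IsSelfAdjoint (defectOp T) := (CFC.sqrt_nonneg (1 - adj T ∘L T)).isSelfAdjoint
  exact h

theorem mem_defectKer_iff (T : E →L[ℂ] F) (hT : ‖T‖ ≤ 1) (x : E) :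
    x ∈ defectKer T ↔ adj T (T x) = x := by
  have h := DFunLike.congr_fun (defectOp_comp_self T hT) x
  have h' : defectOp T (defectOp T x) = x - adj T (T x) := by simpa using h
  have h0 : x ∈ defectKer T ↔ defectOp T x = 0 := Iff.rfl
  rw [h0]
  constructor
  · intro hx
    rw [hx, map_zero] at h'
    exact (sub_eq_zero.mp h'.symm).symm
  · intro hx
    rw [hx, sub_self] at h'
    have h2 : ⟪defectOp T x, defectOp T x⟫_ℂ = 0 := by
      nth_rewrite 1 [← adj_defectOp T]
      rw [ContinuousLinearMap.adjoint_inner_left, h', inner_zero_right]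
    exact inner_self_eq_zero.mp h2

theorem defectSpace_eq (T : E →L[ℂ] F) : defectSpace T = (defectKer T)ᗮ := by
  have h := ContinuousLinearMap.orthogonal_ker (defectOp T)
  have h2 : ContinuousLinearMap.adjoint (defectOp T) = defectOp T := adj_defectOp T
  rw [h2] at h
  exact h.symm

theorem adj_mem_defectSpace (T : E →L[ℂ] F) (hT : ‖T‖ ≤ 1) (y : F)
    (hy : y ∈ defectSpace (adj T)) : adj T y ∈ defectSpace T := by
  rw [defectSpace_eq] at hy ⊢
  rw [Submodule.mem_orthogonal] at hy ⊢
  intro u hu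
  rw [ContinuousLinearMap.adjoint_inner_right]
  apply hy
  have hT' : ‖adj T‖ ≤ 1 := by simpa using hT
  rw [mem_defectKer_iff _ hT']
  rw [mem_defectKer_iff _ hT] at hu
  rw [hu]
  simp

theorem coe_adjDefect (T : E →L[ℂ] F) (hT : ‖T‖ ≤ 1) (y : defectSpace (adj T)) :
    (adjDefect T y : E) = adj T y := by
  have h := adj_mem_defectSpace T hT y y.2
  simpa [adjDefect] using (Submodule.starProjection_eq_self_iff.mpr h)

/-! ### Moore–Penrose pseudo-inverse -/

/-- The graph of the Moore–Penrose pseudo-inverse of `S`: the pairs `(y, x)` such that `x` is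
orthogonal to `ker S` and `S x` is the orthogonal projection of `y` to the closure of `ran S`. -/
def pinvGraph (S : E →L[ℂ] F) : Submodule ℂ (F × E) where
  carrier := {p | p.2 ∈ (LinearMap.ker S.toLinearMap)ᗮ ∧
    p.1 - S p.2 ∈ (LinearMap.range S.toLinearMap)ᗮ}
  zero_mem' := by simp
  add_mem' := by
    rintro ⟨y, x⟩ ⟨y', x'⟩ ⟨h1, h2⟩ ⟨h3, h4⟩
    refine ⟨Submodule.add_mem _ h1 h3, ?_⟩
    have := Submodule.add_mem _ h2 h4
    simpa [add_sub_add_comm] using this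
  smul_mem' := by
    rintro c ⟨y, x⟩ ⟨h1, h2⟩
    refine ⟨Submodule.smul_mem _ c h1, ?_⟩
    have := Submodule.smul_mem _ c h2
    simpa [smul_sub] using this

/-- The Moore–Penrose pseudo-inverse `S⁻¹` of a bounded operator `S : E → F`: the (in general
unbounded) operator with domain `ran S ⊕ (ran S)ᗮ`, see `pinv_domain`, that inverts the restriction
of `S` to `(ker S)ᗮ` and vanishes on `(ran S)ᗮ`. -/
def pinv (S : E →L[ℂ] F) : F →ₗ.[ℂ] E := (pinvGraph S).toLinearPMap

theorem pinv_graph (S : E →L[ℂ] F) : (pinv S).graph = pinvGraph S := by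
  refine Submodule.toLinearPMap_graph_eq _ ?_
  rintro ⟨y, x⟩ ⟨h1, h2⟩ h3
  simp only at h1 h2 h3 ⊢
  subst h3
  have h4 : S x = 0 := by
    have h5 : S x ∈ (LinearMap.range S.toLinearMap)ᗮ := by simpa using h2
    exact inner_self_eq_zero.mp (h5 (S x) ⟨x, rfl⟩)
  exact inner_self_eq_zero.mp (h1 x h4)

theorem pinv_domain (S : E →L[ℂ] F) :
    (pinv S).domain = LinearMap.range S.toLinearMap ⊔ (LinearMap.range S.toLinearMap)ᗮ := by
  ext y
  rw [pinv, Submodule.toLinearPMap_domain]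
  constructor
  · rintro ⟨⟨y', x⟩, ⟨h1, h2⟩, rfl⟩
    exact Submodule.mem_sup.mpr ⟨S x, ⟨x, rfl⟩, _, h2, by simp⟩
  · intro hy
    obtain ⟨_, ⟨x, rfl⟩, z, hz, rfl⟩ := Submodule.mem_sup.mp hy
    let K := LinearMap.ker S.toLinearMap
    have hk : S (K.starProjection x) = 0 := by
      have : K.starProjection x ∈ K := Submodule.starProjection_apply_mem K x
      exact this
    refine ⟨⟨_, x - K.starProjection x⟩, ⟨K.sub_starProjection_mem_orthogonal x, ?_⟩, rfl⟩
    have h2 : S x + z - S (x - K.starProjection x) = z := by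
      rw [map_sub, hk]
      abel
    change S x + z - S (x - K.starProjection x) ∈ _
    rw [h2]
    exact hz

/-- `IsPinvComp S C R` says that `R = S⁻¹ C` with the Moore–Penrose pseudo-inverse `S⁻¹`: for every
`x` the vector `C x` lies in the domain of `S⁻¹`, and `S⁻¹ (C x) = R x`. -/
def IsPinvComp (S : E →L[ℂ] F) (C : G →L[ℂ] F) (R : G →L[ℂ] E) : Prop :=
  ∀ x : G, ∃ hx : C x ∈ (pinv S).domain, pinv S ⟨C x, hx⟩ = R x

/-! ### Discrete-time linear systems -/

/-- A discrete-time linear system `h_{k+1} = A h_k + B ξ_k`, `σ_k = C h_k + D ξ_k` with input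
space `M`, output space `N` and state space `H`, that is, the block operator `[D C; B A]`. -/
structure DiscreteSystem (M N H : Type*)
    [NormedAddCommGroup M] [InnerProductSpace ℂ M]
    [NormedAddCommGroup N] [InnerProductSpace ℂ N]
    [NormedAddCommGroup H] [InnerProductSpace ℂ H] where
  /-- feedthrough operator -/
  D : M →L[ℂ] N
  /-- observation operator -/
  C : H →L[ℂ] N
  /-- control operator -/
  B : M →L[ℂ] H
  /-- state space operator -/
  A : H →L[ℂ] H

namespace DiscreteSystem

variable {M N H : Type*}
  [NormedAddCommGroup M] [InnerProductSpace ℂ M] [CompleteSpace M]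
  [NormedAddCommGroup N] [InnerProductSpace ℂ N] [CompleteSpace N]
  [NormedAddCommGroup H] [InnerProductSpace ℂ H] [CompleteSpace H]

/-- The block operator `(ξ, h) ↦ (D ξ + C h, B ξ + A h)` from the Hilbert space `M ⊕ H` to the
Hilbert space `N ⊕ H`. -/
def blockOp (τ : DiscreteSystem M N H) : WithLp 2 (M × H) →L[ℂ] WithLp 2 (N × H) :=
  (WithLp.prodContinuousLinearEquiv 2 ℂ N H).symm.toContinuousLinearMap ∘L
    ((τ.D.coprod τ.C).prod (τ.B.coprod τ.A)) ∘L
      (WithLp.prodContinuousLinearEquiv 2 ℂ M H).toContinuousLinearMap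

theorem blockOp_apply (τ : DiscreteSystem M N H) (ξ : M) (h : H) :
    τ.blockOp (WithLp.toLp 2 (ξ, h)) = WithLp.toLp 2 (τ.D ξ + τ.C h, τ.B ξ + τ.A h) := rfl

/-- A system is conservative if its block operator is unitary. -/
def IsConservative (τ : DiscreteSystem M N H) : Prop :=
  adj τ.blockOp ∘L τ.blockOp = ContinuousLinearMap.id ℂ _ ∧
    τ.blockOp ∘L adj τ.blockOp = ContinuousLinearMap.id ℂ _

/-- The controllable subspace: the closed linear span of the ranges of `Aⁿ B`, `n ≥ 0`. -/
def controllable (τ : DiscreteSystem M N H) : Submodule ℂ H :=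
  (⨆ n : ℕ, LinearMap.range ((τ.A ^ n) ∘L τ.B).toLinearMap).topologicalClosure

/-- The observable subspace: the closed linear span of the ranges of `A*ⁿ C*`, `n ≥ 0`. -/
def observable (τ : DiscreteSystem M N H) : Submodule ℂ H :=
  (⨆ n : ℕ, LinearMap.range ((adj τ.A ^ n) ∘L adj τ.C).toLinearMap).topologicalClosure

/-- A system is simple if the controllable and observable subspaces together span a dense
subspace of the state space. -/
def IsSimple (τ : DiscreteSystem M N H) : Prop :=
  (τ.controllable ⊔ τ.observable).topologicalClosure = ⊤

/-- `Θ` is, on the unit disk, the transfer function `D + λ C (I - λ A)⁻¹ B` of the system. -/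
def HasTransferFunction (τ : DiscreteSystem M N H) (Θ : ℂ → M →L[ℂ] N) : Prop :=
  ∀ z ∈ Metric.ball (0 : ℂ) 1, IsUnit (1 - z • τ.A) ∧
    Θ z = τ.D + z • (τ.C ∘L Ring.inverse (1 - z • τ.A) ∘L τ.B)

/-- `τ` is a simple conservative system with transfer function `Θ`. -/
structure IsSimpleConservativeRealization (τ : DiscreteSystem M N H) (Θ : ℂ → M →L[ℂ] N) :
    Prop where
  conservative : τ.IsConservative
  simple : τ.IsSimple
  transfer : τ.HasTransferFunction Θ

end DiscreteSystem

/-! ### Schur class, Möbius parameter, first Schur iterate -/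

/-- The Schur class: operator functions that are holomorphic on the open unit disk with
contractive values there. -/
structure IsSchurClass (Θ : ℂ → E →L[ℂ] F) : Prop where
  differentiableOn : DifferentiableOn ℂ Θ (Metric.ball 0 1)
  norm_le_one : ∀ z ∈ Metric.ball (0 : ℂ) 1, ‖Θ z‖ ≤ 1

/-- `Z` is the Möbius parameter of `Θ`: the Schur class function with values in
`L(𝔇_{Θ(0)}, 𝔇_{Θ(0)*})` such that on the unit disk
`Θ(λ) = Θ(0) + D_{Θ(0)*} Z(λ) (I + Θ(0)* Z(λ))⁻¹ D_{Θ(0)}`. -/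
structure IsMoebiusParameter (Θ : ℂ → E →L[ℂ] F)
    (Z : ℂ → defectSpace (Θ 0) →L[ℂ] defectSpace (adj (Θ 0))) : Prop where
  schur : IsSchurClass Z
  isUnit : ∀ z ∈ Metric.ball (0 : ℂ) 1, IsUnit (1 + adjDefect (Θ 0) ∘L Z z)
  representation : ∀ z ∈ Metric.ball (0 : ℂ) 1,
    Θ z = Θ 0 + defectOp (adj (Θ 0)) ∘L (defectSpace (adj (Θ 0))).subtypeL ∘L Z z ∘L
      Ring.inverse (1 + adjDefect (Θ 0) ∘L Z z) ∘L defectCo (Θ 0)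

/-- `Θ₁` is the first Schur iterate of `Θ`: the Schur class function `Θ₁(λ) = Z(λ) / λ`, where `Z`
is the Möbius parameter of `Θ`. -/
def IsFirstSchurIterate (Θ : ℂ → E →L[ℂ] F)
    (Θ₁ : ℂ → defectSpace (Θ 0) →L[ℂ] defectSpace (adj (Θ 0))) : Prop :=
  IsSchurClass Θ₁ ∧ ∃ Z, IsMoebiusParameter Θ Z ∧
    ∀ z ∈ Metric.ball (0 : ℂ) 1, Z z = z • Θ₁ z

end SchurRealization

end

/-! Write `Γ = Θ 0`. Unitarity of the block operator gives `Γ*Γ + B*B = 1` and `ΓΓ* + C C* = 1`, so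
Douglas' factorization yields isometries `W`, `V` on the defect spaces with `B = W D_Γ` and `C* = V
D_{Γ*}` (`exists_isDefectFactorization`). They make the pseudo-inverses explicit: `D_{Γ*}⁻¹C = V*`,
`D_Γ⁻¹B* = W*`, and `D_{A*}⁻¹B` is `W` after projection to `𝔇_Γ`, because `D_{A*} = W D_Γ W*`
(`defectOp_adj_eq`).

Moreover `ker D_A = ker V*`, `ker D_{A*} = ker W*`, and `A` is unitary from the first kernel onto
the second, while `A V = -W Γ*` (`A_V`). Hence `A = A P - W Γ* V*` with `P` the projection onto `ker
D_A`: the given system is `ν = [0 V*; W AP]` closed by the feedback `-Γ*`. The closed-loop formula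
is exactly the Möbius representation of `Θ`, so the transfer function of `ν` is the Möbius parameter
(`isUnit_one_add_transfer`, `transfer_eq_moebius`).

The block operator of `ν` is a sum of unitaries between orthogonal pieces, and its unobservable and
uncontrollable orbits are those of the given system, whence conservativity and simplicity. Its
transfer function is `z` times that of `ζ₁` (`transfer_feedbackSystem`), and `A` restricted to `ker
D_A` is a unitary equivalence of `ζ₂` with `ζ₁`. Uniqueness of the Schur iterate
(`IsFirstSchurIterate.eqOn`) transfers all this to an arbitrary `Θ₁`. -/

noncomputable section

namespace SchurRealization

/-! ### Intertwining of defect operators and Douglas factorization. -/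

section Operators

variable {E F G : Type*}
  [NormedAddCommGroup E] [InnerProductSpace ℂ E] [CompleteSpace E]
  [NormedAddCommGroup F] [InnerProductSpace ℂ F] [CompleteSpace F]
  [NormedAddCommGroup G] [InnerProductSpace ℂ G] [CompleteSpace G]

theorem adj_adj (T : E →L[ℂ] F) : adj (adj T) = T := ContinuousLinearMap.adjoint_adjoint T

theorem adj_comp (S : F →L[ℂ] G) (T : E →L[ℂ] F) : adj (S ∘L T) = adj T ∘L adj S :=
  ContinuousLinearMap.adjoint_comp S T

theorem comp_adj_self_eq_zero {T : E →L[ℂ] F} (h : T ∘L adj T = 0) : T = 0 := by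
  have h1 : adj T = 0 := by
    ext y
    have h2 : ⟪T (adj T y), y⟫_ℂ = 0 := by
      rw [show T (adj T y) = 0 from DFunLike.congr_fun h y, inner_zero_left]
    rw [← ContinuousLinearMap.adjoint_inner_right] at h2
    exact inner_self_eq_zero.mp h2
  rw [← adj_adj T, h1]
  exact map_zero _

/-- Uniqueness for the Sylvester equation with nonnegative coefficients, on the solutions of the
form `P X - X Q`. -/
theorem comp_eq_comp_of_sq {P : E →L[ℂ] E} {Q : F →L[ℂ] F} {X : F →L[ℂ] E}
    (hP : 0 ≤ P) (hQ : 0 ≤ Q) (h : P ∘L P ∘L X = X ∘L Q ∘L Q) : P ∘L X = X ∘L Q := by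
  have hPa : adj P = P := hP.isSelfAdjoint
  have hQa : adj Q = Q := hQ.isSelfAdjoint
  set Y : F →L[ℂ] E := P ∘L X - X ∘L Q with hY
  have hPY : P ∘L Y = -(Y ∘L Q) := by
    rw [hY, ContinuousLinearMap.comp_sub, ContinuousLinearMap.sub_comp, h]
    simp only [ContinuousLinearMap.comp_assoc]
    abel
  have hQpos : (Y ∘L Q ∘L adj Y).IsPositive :=
    ((ContinuousLinearMap.nonneg_iff_isPositive Q).mp hQ).conj_adjoint Y
  have hYpos : (Y ∘L adj Y).IsPositive := by
    have := (ContinuousLinearMap.isPositive_one (𝕜 := ℂ) (E := F)).conj_adjoint Y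
    rwa [ContinuousLinearMap.one_def, ContinuousLinearMap.id_comp] at this
  -- `P Y Y* = -Y Q Y*` is self-adjoint, so `P` commutes with `Y Y*` and the product is nonnegative;
  -- the right side is nonpositive, so both vanish.
  have hprod : P * (Y ∘L adj Y) = -(Y ∘L Q ∘L adj Y) := by
    have := congrArg (fun S => S ∘L adj Y) hPY
    simpa [ContinuousLinearMap.mul_def, ContinuousLinearMap.comp_assoc,
      ContinuousLinearMap.neg_comp] using this
  have hself : IsSelfAdjoint (P * (Y ∘L adj Y)) := by
    rw [hprod]; exact hQpos.isSelfAdjoint.neg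
  have hcomm : Commute P (Y ∘L adj Y) :=
    (hP.isSelfAdjoint.commute_iff hYpos.isSelfAdjoint).mpr hself
  have h0 : 0 ≤ P * (Y ∘L adj Y) :=
    hcomm.mul_nonneg hP ((ContinuousLinearMap.nonneg_iff_isPositive _).mpr hYpos)
  have h1 : 0 ≤ Y ∘L Q ∘L adj Y := (ContinuousLinearMap.nonneg_iff_isPositive _).mpr hQpos
  have h2 : Y ∘L Q ∘L adj Y = 0 := le_antisymm (by rw [hprod] at h0; simpa using h0) h1
  have h3 : P ∘L Y ∘L adj Y = 0 := by
    have := hprod; rw [h2, neg_zero] at this; exact this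
  have h4 : P ∘L Y = 0 := by
    apply comp_adj_self_eq_zero
    rw [adj_comp, hPa, ContinuousLinearMap.comp_assoc, ← ContinuousLinearMap.comp_assoc Y,
      ← ContinuousLinearMap.comp_assoc P, h3, ContinuousLinearMap.zero_comp]
  have h5 : Y ∘L Q = 0 := by rw [h4] at hPY; exact neg_eq_zero.mp hPY.symm
  have h6 : adj Y ∘L P = 0 := by
    have := congrArg adj h4
    simpa [adj_comp, hPa] using this
  have h7 : Q ∘L adj Y = 0 := by
    have := congrArg adj h5
    simpa [adj_comp, hQa] using this
  -- Expanding the inner `Y` as `P X - X Q`, the two terms die by `Y* P = 0` and `Q Y* = 0`.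
  have h8 : Y ∘L adj Y ∘L Y ∘L adj Y = 0 := by
    ext y
    have e6 : ∀ x, adj Y (P x) = 0 := DFunLike.congr_fun h6
    have e7 : ∀ x, Q (adj Y x) = 0 := DFunLike.congr_fun h7
    have e : Y (adj Y y) = P (X (adj Y y)) - X (Q (adj Y y)) := rfl
    change Y (adj Y (Y (adj Y y))) = 0
    rw [e, map_sub, e6, e7]
    simp
  have h9 : Y ∘L adj Y = 0 := by
    apply comp_adj_self_eq_zero
    rw [adj_comp, adj_adj, ContinuousLinearMap.comp_assoc]
    exact h8
  exact sub_eq_zero.mp (comp_adj_self_eq_zero h9)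

theorem defectOp_nonneg (T : E →L[ℂ] F) : 0 ≤ defectOp T := CFC.sqrt_nonneg _

theorem norm_adj_le_one {T : E →L[ℂ] F} (hT : ‖T‖ ≤ 1) : ‖adj T‖ ≤ 1 := by simpa using hT

theorem defectOp_defectOp (T : E →L[ℂ] F) (hT : ‖T‖ ≤ 1) (x : E) :
    defectOp T (defectOp T x) = x - adj T (T x) :=
  DFunLike.congr_fun (defectOp_comp_self T hT) x

/-- The squares `1 - T*T` and `1 - TT*` are intertwined by `T*`; `comp_eq_comp_of_sq` passes to the
square roots without functional calculus. -/
theorem defectOp_adj_apply (T : E →L[ℂ] F) (hT : ‖T‖ ≤ 1) (y : F) :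
    defectOp T (adj T y) = adj T (defectOp (adj T) y) := by
  have h : defectOp T ∘L defectOp T ∘L adj T =
      adj T ∘L defectOp (adj T) ∘L defectOp (adj T) := by
    ext y
    have h1 := defectOp_defectOp T hT (adj T y)
    have h2 := defectOp_defectOp (adj T) (norm_adj_le_one hT) y
    rw [adj_adj] at h2
    simp only [ContinuousLinearMap.comp_apply]
    rw [h1, h2, map_sub]
  exact DFunLike.congr_fun (comp_eq_comp_of_sq (defectOp_nonneg T) (defectOp_nonneg _) h) y

@[simp] theorem coe_defectCo (T : E →L[ℂ] F) (x : E) : (defectCo T x : E) = defectOp T x := rfl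

theorem defectCo_adj_apply (T : E →L[ℂ] F) (hT : ‖T‖ ≤ 1) (y : F) :
    defectCo T (adj T y) = adjDefect T (defectCo (adj T) y) := by
  apply Subtype.ext
  rw [coe_adjDefect T hT]
  exact defectOp_adj_apply T hT y

theorem denseRange_defectCo (T : E →L[ℂ] F) : DenseRange (defectCo T) := by
  intro y
  rw [closure_subtype]
  have h : (Subtype.val '' Set.range (defectCo T)) =
      (LinearMap.range (defectOp T).toLinearMap : Set E) := by
    ext x
    constructor
    · rintro ⟨_, ⟨x, rfl⟩, rfl⟩; exact ⟨x, rfl⟩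
    · rintro ⟨x, rfl⟩; exact ⟨_, ⟨x, rfl⟩, rfl⟩
  rw [h]
  exact y.2

theorem adj_defectCo_apply (T : E →L[ℂ] F) (u : defectSpace T) :
    adj (defectCo T) u = defectOp T u := by
  apply ext_inner_right ℂ
  intro x
  rw [ContinuousLinearMap.adjoint_inner_left, Submodule.coe_inner, coe_defectCo]
  conv_rhs => rw [← adj_defectOp T, ContinuousLinearMap.adjoint_inner_left]

theorem defectOp_injOn (T : E →L[ℂ] F) {u : E} (hu : u ∈ defectSpace T) (h : defectOp T u = 0) :
    u = 0 := by
  rw [defectSpace_eq] at hu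
  exact inner_self_eq_zero.mp (hu u h)

theorem norm_sq_add_norm_sq {T : E →L[ℂ] F} {S : E →L[ℂ] G}
    (h : ∀ x, adj T (T x) + adj S (S x) = x) (x : E) : ‖T x‖ ^ 2 + ‖S x‖ ^ 2 = ‖x‖ ^ 2 := by
  have h1 : ⟪adj T (T x) + adj S (S x), x⟫_ℂ = ⟪x, x⟫_ℂ := by rw [h]
  rw [inner_add_left, ContinuousLinearMap.adjoint_inner_left,
    ContinuousLinearMap.adjoint_inner_left] at h1
  simp only [inner_self_eq_norm_sq_to_K] at h1
  exact_mod_cast h1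

theorem norm_le_one_of_add {T : E →L[ℂ] F} {S : E →L[ℂ] G}
    (h : ∀ x, adj T (T x) + adj S (S x) = x) : ‖T‖ ≤ 1 := by
  refine T.opNorm_le_bound zero_le_one fun x => ?_
  have := norm_sq_add_norm_sq h x
  rw [one_mul]
  exact (sq_le_sq₀ (norm_nonneg _) (norm_nonneg _)).mp (by nlinarith [sq_nonneg ‖S x‖])

/-- Douglas' factorization through a defect operator: if `T* T + S* S = 1`, then `S = V D_T` with an
isometry `V` on the defect space of `T`. -/
theorem exists_isometry_comp_defectCo {T : E →L[ℂ] F} {S : E →L[ℂ] G}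
    (h : ∀ x, adj T (T x) + adj S (S x) = x) :
    ∃ V : defectSpace T →L[ℂ] G, (∀ x, V (defectCo T x) = S x) ∧ ∀ u, adj V (V u) = u := by
  have hT := norm_le_one_of_add h
  -- Both squared norms equal `‖x‖² - ‖T x‖²`, so `D_T x ↦ S x` is well defined and isometric on a
  -- dense subspace.
  have hn : ∀ x, ‖S x‖ = ‖defectCo T x‖ := by
    intro x
    have h1 := norm_sq_add_norm_sq h x
    have h2 : ‖T x‖ ^ 2 + ‖defectOp T x‖ ^ 2 = ‖x‖ ^ 2 := by
      apply norm_sq_add_norm_sq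
      intro x
      rw [adj_defectOp, defectOp_defectOp T hT]
      abel
    have h3 : ‖defectCo T x‖ = ‖defectOp T x‖ := rfl
    rw [h3]
    exact (sq_eq_sq₀ (norm_nonneg _) (norm_nonneg _)).mp (by linarith)
  have hd : DenseRange (defectCo T).toLinearMap := denseRange_defectCo T
  let V : defectSpace T →L[ℂ] G := S.toLinearMap.extendOfNorm (defectCo T).toLinearMap
  have hV : ∀ x, V (defectCo T x) = S x :=
    LinearMap.extendOfNorm_eq (f := S.toLinearMap) hd ⟨1, fun x => by simpa using (hn x).le⟩
  refine ⟨V, hV, ?_⟩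
  have hiso : ∀ u, ‖V u‖ = ‖u‖ := by
    intro u
    refine (denseRange_defectCo T).induction_on (p := fun u => ‖V u‖ = ‖u‖) u
      (isClosed_eq (by fun_prop) (by fun_prop)) fun x => ?_
    rw [hV, hn]
  intro u
  exact DFunLike.congr_fun ((ContinuousLinearMap.norm_map_iff_adjoint_comp_self V).mp hiso) u

/-- The sufficient condition for `R = S⁻¹ C`. -/
theorem isPinvComp_of {S : E →L[ℂ] F} {C : G →L[ℂ] F} {R : G →L[ℂ] E}
    (h1 : ∀ x, R x ∈ (LinearMap.ker S.toLinearMap)ᗮ) (h2 : ∀ x, S (R x) = C x) :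
    IsPinvComp S C R := by
  intro x
  have h : (C x, R x) ∈ (pinv S).graph := by
    rw [pinv_graph]
    exact ⟨h1 x, by simp [h2]⟩
  obtain ⟨y, hy1, hy2⟩ := (LinearPMap.mem_graph_iff _).mp h
  simp only at hy1 hy2
  have hx : C x ∈ (pinv S).domain := hy1 ▸ y.2
  refine ⟨hx, ?_⟩
  rw [← hy2]
  congr 1
  exact Subtype.ext hy1.symm

theorem isUnit_one_sub_smul {A : E →L[ℂ] E} (hA : ‖A‖ ≤ 1) {z : ℂ}
    (hz : z ∈ Metric.ball (0 : ℂ) 1) : IsUnit (1 - z • A) := by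
  apply isUnit_one_sub_of_norm_lt_one
  rw [norm_smul]
  have : ‖z‖ < 1 := by simpa using hz
  nlinarith [norm_nonneg z, norm_nonneg A]

theorem inverse_apply_eq {a : E →L[ℂ] E} (ha : IsUnit a) {x y : E} (h : a x = y) :
    Ring.inverse a y = x := by
  rw [← h]
  exact DFunLike.congr_fun (Ring.inverse_mul_cancel a ha) x

theorem apply_inverse {a : E →L[ℂ] E} (ha : IsUnit a) (y : E) : a (Ring.inverse a y) = y :=
  DFunLike.congr_fun (Ring.mul_inverse_cancel a ha) y

theorem coe_adj_subtype (K : Submodule ℂ E) [CompleteSpace K] :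
    adj K.subtypeL = K.orthogonalProjectionOnto := Submodule.adjoint_subtypeL K

end Operators

/-! ### Conservative systems, simplicity, transfer functions and unitary equivalence. -/

namespace DiscreteSystem

section Systems

variable {M N H H' : Type*}
  [NormedAddCommGroup M] [InnerProductSpace ℂ M] [CompleteSpace M]
  [NormedAddCommGroup N] [InnerProductSpace ℂ N] [CompleteSpace N]
  [NormedAddCommGroup H] [InnerProductSpace ℂ H] [CompleteSpace H]
  [NormedAddCommGroup H'] [InnerProductSpace ℂ H'] [CompleteSpace H']

/-- The adjoint system, with block operator the adjoint of the block operator. -/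
def adjoint (τ : DiscreteSystem M N H) : DiscreteSystem N M H where
  D := adj τ.D
  C := adj τ.B
  B := adj τ.C
  A := adj τ.A

theorem adj_blockOp (τ : DiscreteSystem M N H) : adj τ.blockOp = τ.adjoint.blockOp := by
  symm
  rw [ContinuousLinearMap.eq_adjoint_iff]
  rintro ⟨η, h⟩ ⟨ξ, k⟩
  rw [blockOp_apply, blockOp_apply, WithLp.prod_inner_apply, WithLp.prod_inner_apply]
  simp only [adjoint, inner_add_left, inner_add_right, ContinuousLinearMap.adjoint_inner_left]
  ring

theorem toLp_eq_iff {X Y : Type*} {p q : X × Y} :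
    WithLp.toLp 2 p = WithLp.toLp 2 q ↔ p.1 = q.1 ∧ p.2 = q.2 := by
  rw [(WithLp.toLp_injective 2).eq_iff, Prod.ext_iff]

theorem isConservative_iff (τ : DiscreteSystem M N H) : τ.IsConservative ↔
    (∀ ξ h, adj τ.D (τ.D ξ + τ.C h) + adj τ.B (τ.B ξ + τ.A h) = ξ ∧
      adj τ.C (τ.D ξ + τ.C h) + adj τ.A (τ.B ξ + τ.A h) = h) ∧
    ∀ η h, τ.D (adj τ.D η + adj τ.B h) + τ.C (adj τ.C η + adj τ.A h) = η ∧
      τ.B (adj τ.D η + adj τ.B h) + τ.A (adj τ.C η + adj τ.A h) = h := by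
  rw [IsConservative, adj_blockOp]
  constructor
  · rintro ⟨h1, h2⟩
    refine ⟨fun ξ h => toLp_eq_iff.mp (DFunLike.congr_fun h1 (WithLp.toLp 2 (ξ, h))),
      fun η h => toLp_eq_iff.mp (DFunLike.congr_fun h2 (WithLp.toLp 2 (η, h)))⟩
  · rintro ⟨h1, h2⟩
    constructor
    · apply ContinuousLinearMap.ext
      rintro ⟨ξ, h⟩
      exact toLp_eq_iff.mpr (h1 ξ h)
    · apply ContinuousLinearMap.ext
      rintro ⟨η, h⟩
      exact toLp_eq_iff.mpr (h2 η h)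

theorem adj_pow_comp (A : H →L[ℂ] H) (B : M →L[ℂ] H) (n : ℕ) :
    adj ((A ^ n) ∘L B) = adj B ∘L (adj A ^ n) := by
  rw [adj_comp]
  congr 1
  exact star_pow A n

/-- Dual form of simplicity, by taking orthogonal complements: no nonzero vector is annihilated
along both orbits. Every simplicity proof uses this form. -/
theorem isSimple_iff (τ : DiscreteSystem M N H) : τ.IsSimple ↔
    ∀ x, (∀ n, adj τ.B ((adj τ.A ^ n) x) = 0) → (∀ n, τ.C ((τ.A ^ n) x) = 0) → x = 0 := by
  rw [IsSimple, Submodule.topologicalClosure_eq_top_iff, ← Submodule.inf_orthogonal, controllable,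
    observable, Submodule.orthogonal_closure, Submodule.orthogonal_closure,
    ← Submodule.iInf_orthogonal, ← Submodule.iInf_orthogonal, Submodule.eq_bot_iff]
  have h1 : ∀ (x : H) (n : ℕ), x ∈ (LinearMap.range ((τ.A ^ n) ∘L τ.B).toLinearMap)ᗮ ↔
      adj τ.B ((adj τ.A ^ n) x) = 0 := by
    intro x n
    have := ContinuousLinearMap.orthogonal_range ((τ.A ^ n) ∘L τ.B)
    rw [this, ← ContinuousLinearMap.comp_apply, ← adj_pow_comp]
    rfl
  have h2 : ∀ (x : H) (n : ℕ), x ∈ (LinearMap.range ((adj τ.A ^ n) ∘L adj τ.C).toLinearMap)ᗮ ↔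
      τ.C ((τ.A ^ n) x) = 0 := by
    intro x n
    have := ContinuousLinearMap.orthogonal_range ((adj τ.A ^ n) ∘L adj τ.C)
    have h3 := adj_pow_comp (adj τ.A) (adj τ.C) n
    rw [adj_adj, adj_adj] at h3
    rw [this, ← ContinuousLinearMap.comp_apply, ← h3]
    rfl
  simp only [Submodule.mem_inf, Submodule.mem_iInf, h1, h2, and_imp]

/-- The transfer function as a function on the whole plane, with junk values where `1 - z A` is not
invertible. -/
def transfer (τ : DiscreteSystem M N H) (z : ℂ) : M →L[ℂ] N :=
  τ.D + z • (τ.C ∘L Ring.inverse (1 - z • τ.A) ∘L τ.B)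

/-- Together with `exists_state` this replaces resolvent algebra by the state equation: to compare
two transfer functions it suffices to convert a state of one system into a state of the other. -/
theorem transfer_apply_eq {τ : DiscreteSystem M N H} (hA : ‖τ.A‖ ≤ 1) {z : ℂ}
    (hz : z ∈ Metric.ball (0 : ℂ) 1) {ξ : M} {g : H} (h : g = τ.B ξ + z • τ.A g) :
    τ.transfer z ξ = τ.D ξ + z • τ.C g := by
  have h1 : (1 - z • τ.A) g = τ.B ξ := by
    simpa using sub_eq_iff_eq_add.mpr h
  have h2 := inverse_apply_eq (isUnit_one_sub_smul hA hz) h1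
  simp [transfer, h2]

theorem exists_state {τ : DiscreteSystem M N H} (hA : ‖τ.A‖ ≤ 1) {z : ℂ}
    (hz : z ∈ Metric.ball (0 : ℂ) 1) (ξ : M) :
    ∃ g, g = τ.B ξ + z • τ.A g ∧ τ.transfer z ξ = τ.D ξ + z • τ.C g := by
  have h1 := apply_inverse (isUnit_one_sub_smul hA hz) (τ.B ξ)
  have h2 : Ring.inverse (1 - z • τ.A) (τ.B ξ) =
      τ.B ξ + z • τ.A (Ring.inverse (1 - z • τ.A) (τ.B ξ)) := by
    apply sub_eq_iff_eq_add.mp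
    simpa using h1
  exact ⟨_, h2, transfer_apply_eq hA hz h2⟩

theorem hasTransferFunction_iff {τ : DiscreteSystem M N H} (hA : ‖τ.A‖ ≤ 1)
    {Θ : ℂ → M →L[ℂ] N} :
    τ.HasTransferFunction Θ ↔ ∀ z ∈ Metric.ball (0 : ℂ) 1, Θ z = τ.transfer z :=
  forall₂_congr fun _ hz => and_iff_right (isUnit_one_sub_smul hA hz)

theorem norm_A_le_one {τ : DiscreteSystem M N H} (hτ : τ.IsConservative) : ‖τ.A‖ ≤ 1 := by
  have h := ((isConservative_iff τ).mp hτ).1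
  refine norm_le_one_of_add (S := τ.C) fun x => ?_
  have := (h 0 x).2
  simpa [add_comm] using this

theorem norm_output_sq {τ : DiscreteSystem M N H} (hτ : τ.IsConservative) (ξ : M) (h : H) :
    ‖τ.D ξ + τ.C h‖ ^ 2 + ‖τ.B ξ + τ.A h‖ ^ 2 = ‖ξ‖ ^ 2 + ‖h‖ ^ 2 := by
  have h1 := (ContinuousLinearMap.norm_map_iff_adjoint_comp_self τ.blockOp).mpr hτ.1
    (WithLp.toLp 2 (ξ, h))
  have h2 := congrArg (· ^ 2) h1
  simp only [blockOp_apply] at h2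
  rwa [WithLp.prod_norm_sq_eq_of_L2, WithLp.prod_norm_sq_eq_of_L2] at h2

theorem isSchurClass_transfer {τ : DiscreteSystem M N H} (hτ : τ.IsConservative) :
    IsSchurClass τ.transfer := by
  have hA := norm_A_le_one hτ
  constructor
  · intro z hz
    have h1 : DifferentiableAt ℂ (fun z : ℂ => Ring.inverse (1 - z • τ.A)) z :=
      by
      have h2 : DifferentiableAt ℂ (fun z : ℂ => 1 - z • τ.A) z := by fun_prop
      exact (differentiableAt_inverse (isUnit_one_sub_smul hA hz)).comp z h2
    apply DifferentiableAt.differentiableWithinAt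
    unfold transfer
    fun_prop
  · intro z hz
    refine ContinuousLinearMap.opNorm_le_bound _ zero_le_one fun ξ => ?_
    obtain ⟨g, hg, ht⟩ := exists_state hA hz ξ
    -- Energy balance at the state `z • g`, whose successor is `g`: the squared output norm is `‖ξ‖²
    -- - (1 - |z|²)‖g‖²`.
    have h1 := norm_output_sq hτ ξ (z • g)
    rw [map_smul, map_smul, ← hg, ← ht, norm_smul, mul_pow] at h1
    have h2 : ‖z‖ ^ 2 ≤ 1 := by
      have : ‖z‖ < 1 := by simpa using hz
      nlinarith [norm_nonneg z]
    rw [one_mul]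
    exact (sq_le_sq₀ (norm_nonneg _) (norm_nonneg _)).mp (by nlinarith [sq_nonneg ‖g‖])

/-- Unitarily equivalent systems realize the same functions. -/
theorem IsSimpleConservativeRealization.of_unitary {τ : DiscreteSystem M N H}
    {τ' : DiscreteSystem M N H'} {Θ : ℂ → M →L[ℂ] N} (hτ : τ.IsSimpleConservativeRealization Θ)
    (V : H' →L[ℂ] H) (hV : ∀ x, adj V (V x) = x) (hV' : ∀ x, V (adj V x) = x)
    (hD : τ'.D = τ.D) (hC : τ'.C = τ.C ∘L V) (hB : V ∘L τ'.B = τ.B)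
    (hA : V ∘L τ'.A = τ.A ∘L V) : τ'.IsSimpleConservativeRealization Θ := by
  obtain ⟨D', C', B', A'⟩ := τ'
  obtain ⟨D, C, B, A⟩ := τ
  simp only at hD hC hB hA
  have hVV : adj V ∘L V = ContinuousLinearMap.id ℂ H' := ContinuousLinearMap.ext hV
  have hB' : B' = adj V ∘L B := by
    rw [← hB, ← ContinuousLinearMap.comp_assoc, hVV, ContinuousLinearMap.id_comp]
  have hA' : A' = adj V ∘L A ∘L V := by
    rw [← hA, ← ContinuousLinearMap.comp_assoc, hVV, ContinuousLinearMap.id_comp]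
  subst hD hC hB' hA'
  have hc := (isConservative_iff _).mp hτ.conservative
  have hc' : (⟨D', C ∘L V, adj V ∘L B, adj V ∘L A ∘L V⟩ :
      DiscreteSystem M N H').IsConservative := by
    rw [isConservative_iff]
    simp only [adj_comp, adj_adj, ContinuousLinearMap.comp_apply, ← map_add, hV'] at hc ⊢
    refine ⟨fun ξ h => ?_, fun η h => ?_⟩
    · obtain ⟨h1, h2⟩ := hc.1 ξ (V h)
      exact ⟨h1, by rw [h2, hV]⟩
    · obtain ⟨h1, h2⟩ := hc.2 η (V h)
      exact ⟨h1, by rw [h2, hV]⟩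
  refine ⟨hc', ?_, ?_⟩
  · rw [isSimple_iff]
    intro x h1 h2
    have p1 : ∀ n, V (((adj V ∘L A ∘L V) ^ n) x) = (A ^ n) (V x) := by
      intro n
      induction n with
      | zero => rfl
      | succ n ih =>
        rw [pow_succ', pow_succ', mul_apply_eq_comp, mul_apply_eq_comp,
          ← ih]
        exact hV' _
    have p2 : ∀ n, V ((adj (adj V ∘L A ∘L V) ^ n) x) = (adj A ^ n) (V x) := by
      intro n
      induction n with
      | zero => rfl
      | succ n ih =>
        rw [pow_succ', pow_succ', mul_apply_eq_comp, mul_apply_eq_comp,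
          ← ih, adj_comp, adj_comp, adj_adj]
        exact hV' _
    have h3 : V x = 0 := by
      apply (isSimple_iff _).mp hτ.simple
      · intro n
        have := h1 n
        simp only [adj_comp (adj V) B, adj_adj, ContinuousLinearMap.comp_apply] at this
        rw [p2] at this
        exact this
      · intro n
        have := h2 n
        rw [ContinuousLinearMap.comp_apply, p1] at this
        exact this
    rw [← hV x, h3, map_zero]
  · rw [hasTransferFunction_iff (norm_A_le_one hc')]
    have ht := (hasTransferFunction_iff (norm_A_le_one hτ.conservative)).mp hτ.transfer
    intro z hz
    ext ξ
    obtain ⟨g, hg, h⟩ := exists_state (norm_A_le_one hc') hz ξ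
    rw [ht z hz, h]
    have hg' : V g = B ξ + z • A (V g) := by
      conv_lhs => rw [hg]
      simp [hV']
    exact transfer_apply_eq (norm_A_le_one hτ.conservative) hz hg'

end Systems

end DiscreteSystem

/-! ### Uniqueness of the Möbius parameter and of the first Schur iterate. -/

section Moebius

variable {M N : Type*}
  [NormedAddCommGroup M] [InnerProductSpace ℂ M] [CompleteSpace M]
  [NormedAddCommGroup N] [InnerProductSpace ℂ N] [CompleteSpace N]

/-- Since `(1 + SZ)⁻¹ = 1 - S (Z (1 + SZ)⁻¹)`, the product `Z (1 + SZ)⁻¹` determines the inverse,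
and then `Z`. -/
theorem eq_of_comp_inverse_eq {E F : Type*} [NormedAddCommGroup E] [InnerProductSpace ℂ E] [CompleteSpace E]
    [NormedAddCommGroup F] [InnerProductSpace ℂ F] {S : F →L[ℂ] E} {Z Z' : E →L[ℂ] F}
    (h1 : IsUnit (1 + S ∘L Z)) (h1' : IsUnit (1 + S ∘L Z'))
    (h : Z ∘L Ring.inverse (1 + S ∘L Z) = Z' ∘L Ring.inverse (1 + S ∘L Z')) : Z = Z' := by
  have key : ∀ {Y : E →L[ℂ] F}, IsUnit (1 + S ∘L Y) →
      Ring.inverse (1 + S ∘L Y) = 1 - S ∘L Y ∘L Ring.inverse (1 + S ∘L Y) := by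
    intro Y hY
    have := Ring.mul_inverse_cancel _ hY
    rw [add_mul, one_mul] at this
    exact eq_sub_of_add_eq this
  have h2 : Ring.inverse (1 + S ∘L Z) = Ring.inverse (1 + S ∘L Z') := by
    rw [key h1, h, ← key h1']
  have h3 : (1 + S ∘L Z) = (1 + S ∘L Z') := by
    rw [← Ring.inverse_inverse h1, h2, Ring.inverse_inverse h1']
  ext x
  have h4 := DFunLike.congr_fun h ((1 + S ∘L Z) x)
  have e1 : Ring.inverse (1 + S ∘L Z) ((1 + S ∘L Z) x) = x := inverse_apply_eq h1 rfl
  rw [ContinuousLinearMap.comp_apply, ContinuousLinearMap.comp_apply, ← h2, e1] at h4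
  exact h4

/-- The outer factors cancel: `D_Γ` has dense range in `𝔇_Γ`, and `D_{Γ*}` is injective on `𝔇_{Γ*}`.
-/
theorem IsMoebiusParameter.eqOn {Θ : ℂ → M →L[ℂ] N}
    {Z Z' : ℂ → defectSpace (Θ 0) →L[ℂ] defectSpace (adj (Θ 0))}
    (hZ : IsMoebiusParameter Θ Z) (hZ' : IsMoebiusParameter Θ Z') :
    ∀ z ∈ Metric.ball (0 : ℂ) 1, Z z = Z' z := by
  intro z hz
  apply eq_of_comp_inverse_eq (hZ.isUnit z hz) (hZ'.isUnit z hz)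
  apply DFunLike.coe_injective
  refine (denseRange_defectCo (Θ 0)).equalizer (by fun_prop) (by fun_prop) ?_
  ext x
  have h := DFunLike.congr_fun ((hZ.representation z hz).symm.trans (hZ'.representation z hz)) x
  have h' := add_left_cancel h
  set a := Z z (Ring.inverse (1 + adjDefect (Θ 0) ∘L Z z) (defectCo (Θ 0) x))
  set b := Z' z (Ring.inverse (1 + adjDefect (Θ 0) ∘L Z' z) (defectCo (Θ 0) x))
  have h2 : defectOp (adj (Θ 0)) ((a - b : defectSpace (adj (Θ 0))) : N) = 0 := by
    rw [Submodule.coe_sub, map_sub]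
    exact sub_eq_zero.mpr h'
  exact congrArg Subtype.val (sub_eq_zero.mp (Subtype.ext (defectOp_injOn _ (a - b).2 h2)))

/-- Off the origin one divides by `z`; at the origin, where the equation says nothing, continuity
decides. -/
theorem IsFirstSchurIterate.eqOn {Θ : ℂ → M →L[ℂ] N}
    {Θ₁ Θ₁' : ℂ → defectSpace (Θ 0) →L[ℂ] defectSpace (adj (Θ 0))}
    (h : IsFirstSchurIterate Θ Θ₁) (h' : IsFirstSchurIterate Θ Θ₁') :
    ∀ z ∈ Metric.ball (0 : ℂ) 1, Θ₁ z = Θ₁' z := by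
  obtain ⟨hs, Z, hZ, e⟩ := h
  obtain ⟨hs', Z', hZ', e'⟩ := h'
  have h1 : ∀ z ∈ Metric.ball (0 : ℂ) 1, z ≠ 0 → Θ₁ z = Θ₁' z := by
    intro z hz h0
    have := hZ.eqOn hZ' z hz
    rw [e z hz, e' z hz] at this
    exact smul_right_injective _ h0 this
  intro z hz
  rcases eq_or_ne z 0 with rfl | h0
  · have hb : Metric.ball (0 : ℂ) 1 ∈ nhds (0 : ℂ) := Metric.ball_mem_nhds _ one_pos
    have c : ContinuousAt Θ₁ 0 := (hs.differentiableOn.differentiableAt hb).continuousAt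
    have c' : ContinuousAt Θ₁' 0 := (hs'.differentiableOn.differentiableAt hb).continuousAt
    have ev : Θ₁ =ᶠ[nhdsWithin 0 {0}ᶜ] Θ₁' := by
      filter_upwards [self_mem_nhdsWithin, mem_nhdsWithin_of_mem_nhds hb] with w hw hw'
      exact h1 w hw' hw
    exact tendsto_nhds_unique (c.tendsto.mono_left nhdsWithin_le_nhds)
      ((c'.tendsto.mono_left nhdsWithin_le_nhds).congr' ev.symm)
  · exact h1 z hz h0

end Moebius

/-! ### The isometries `W`, `V` and the geometry of `ker D_A` and `ker D_{A*}`. -/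

section Factorization

section Projections

variable {E F H : Type*}
  [NormedAddCommGroup E] [InnerProductSpace ℂ E] [CompleteSpace E]
  [NormedAddCommGroup F] [InnerProductSpace ℂ F] [CompleteSpace F]
  [NormedAddCommGroup H] [InnerProductSpace ℂ H] [CompleteSpace H]

theorem starProjection_of_isometry {K : Submodule ℂ H} [K.HasOrthogonalProjection]
    {V : E →L[ℂ] H} (hV : ∀ u, adj V (V u) = u) (hK : ∀ x, x ∈ K ↔ adj V x = 0) (x : H) :
    K.starProjection x = x - V (adj V x) := by
  refine (Submodule.eq_starProjection_of_mem_of_inner_eq_zero ?_ ?_)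
  · rw [hK, map_sub, hV, sub_self]
  · intro w hw
    rw [hK] at hw
    rw [sub_sub_cancel, ← ContinuousLinearMap.adjoint_inner_right, hw, inner_zero_right]

theorem adj_orthogonalProjectionOnto (K : Submodule ℂ E) [CompleteSpace K] :
    adj K.orthogonalProjectionOnto = K.subtypeL := by
  rw [← coe_adj_subtype, adj_adj]

/-- `x - T*T x = S*S x` vanishes exactly when `S x` does. Applied to `A` and `A*`, this identifies
the defect kernels with `ker V*` and `ker W*`. -/
theorem mem_defectKer_iff_adj_isometry {T : H →L[ℂ] H} {S : H →L[ℂ] F} {V : E →L[ℂ] H}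
    (h : ∀ x, adj T (T x) + adj S (S x) = x) (hS : ∀ x, S x = 0 ↔ adj V x = 0) (x : H) :
    x ∈ defectKer T ↔ adj V x = 0 := by
  rw [mem_defectKer_iff T (norm_le_one_of_add h), ← hS]
  constructor
  · intro h1
    have h2 := h x
    rw [h1, add_eq_left] at h2
    have : ⟪adj S (S x), x⟫_ℂ = 0 := by rw [h2, inner_zero_left]
    rw [ContinuousLinearMap.adjoint_inner_left] at this
    exact inner_self_eq_zero.mp this
  · intro h1
    simpa [h1] using h x

end Projections

variable {M N H : Type*}
  [NormedAddCommGroup M] [InnerProductSpace ℂ M] [CompleteSpace M]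
  [NormedAddCommGroup N] [InnerProductSpace ℂ N] [CompleteSpace N]
  [NormedAddCommGroup H] [InnerProductSpace ℂ H] [CompleteSpace H]

/-- The isometries `W`, `V` on the defect spaces of the feedthrough operator `Γ` of a conservative
system `[Γ C; B A]` with `B = W D_Γ` and `C* = V D_{Γ*}`. -/
structure IsDefectFactorization (Γ : M →L[ℂ] N) (C : H →L[ℂ] N) (B : M →L[ℂ] H) (A : H →L[ℂ] H)
    (W : defectSpace Γ →L[ℂ] H) (V : defectSpace (adj Γ) →L[ℂ] H) : Prop where
  conservative : ({ D := Γ, C := C, B := B, A := A } : DiscreteSystem M N H).IsConservative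
  W_defectCo : ∀ x, W (defectCo Γ x) = B x
  adj_W_W : ∀ u, adj W (W u) = u
  V_defectCo : ∀ y, V (defectCo (adj Γ) y) = adj C y
  adj_V_V : ∀ u, adj V (V u) = u

theorem exists_isDefectFactorization {Γ : M →L[ℂ] N} {C : H →L[ℂ] N} {B : M →L[ℂ] H}
    {A : H →L[ℂ] H}
    (h : ({ D := Γ, C := C, B := B, A := A } : DiscreteSystem M N H).IsConservative) :
    ∃ W V, IsDefectFactorization Γ C B A W V := by
  obtain ⟨h1, h2⟩ := (DiscreteSystem.isConservative_iff _).mp h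
  obtain ⟨W, hW, hW'⟩ := exists_isometry_comp_defectCo (T := Γ) (S := B) fun x => by
    simpa using (h1 x 0).1
  obtain ⟨V, hV, hV'⟩ := exists_isometry_comp_defectCo (T := adj Γ) (S := adj C) fun x => by
    simpa using (h2 x 0).1
  exact ⟨W, V, h, hW, hW', hV, hV'⟩

namespace IsDefectFactorization

variable {Γ : M →L[ℂ] N} {C : H →L[ℂ] N} {B : M →L[ℂ] H} {A : H →L[ℂ] H}
  {W : defectSpace Γ →L[ℂ] H} {V : defectSpace (adj Γ) →L[ℂ] H}

section Relations

variable (h : IsDefectFactorization Γ C B A W V)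
include h

theorem norm_feedthrough : ‖Γ‖ ≤ 1 :=
  norm_le_one_of_add (S := B) fun x => by
    simpa using (((DiscreteSystem.isConservative_iff _).mp h.conservative).1 x 0).1

theorem adj_A_A_add (x : H) : adj A (A x) + adj C (C x) = x := by
  have := (((DiscreteSystem.isConservative_iff _).mp h.conservative).1 0 x).2
  simpa [add_comm] using this

theorem A_adj_A_add (x : H) : A (adj A x) + B (adj B x) = x := by
  have := (((DiscreteSystem.isConservative_iff _).mp h.conservative).2 0 x).2
  simpa [add_comm] using this

theorem norm_A : ‖A‖ ≤ 1 := norm_le_one_of_add h.adj_A_A_add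

theorem norm_adj_A : ‖adj A‖ ≤ 1 := norm_adj_le_one h.norm_A

theorem C_eq (x : H) : C x = defectOp (adj Γ) (adj V x) := by
  have h1 : V ∘L defectCo (adj Γ) = adj C := ContinuousLinearMap.ext h.V_defectCo
  have h2 : C = adj (defectCo (adj Γ)) ∘L adj V := by rw [← adj_comp, h1, adj_adj]
  rw [h2]
  exact adj_defectCo_apply _ _

theorem adj_B_eq (x : H) : adj B x = defectOp Γ (adj W x) := by
  have h1 : W ∘L defectCo Γ = B := ContinuousLinearMap.ext h.W_defectCo
  rw [← h1, adj_comp]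
  exact adj_defectCo_apply _ _

theorem C_eq_zero_iff (x : H) : C x = 0 ↔ adj V x = 0 := by
  rw [h.C_eq]
  exact ⟨fun h1 => Subtype.ext (defectOp_injOn _ (adj V x).2 h1), fun h1 => by simp [h1]⟩

theorem adj_B_eq_zero_iff (x : H) : adj B x = 0 ↔ adj W x = 0 := by
  rw [h.adj_B_eq]
  exact ⟨fun h1 => Subtype.ext (defectOp_injOn _ (adj W x).2 h1), fun h1 => by simp [h1]⟩

theorem mem_ker (x : H) : x ∈ defectKer A ↔ adj V x = 0 :=
  mem_defectKer_iff_adj_isometry h.adj_A_A_add h.C_eq_zero_iff x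

theorem mem_ker_adj (x : H) : x ∈ defectKer (adj A) ↔ adj W x = 0 :=
  mem_defectKer_iff_adj_isometry (S := adj B)
    (by simpa only [adj_adj] using h.A_adj_A_add) h.adj_B_eq_zero_iff x

theorem proj_add (x : H) : (defectKer A).starProjection x + V (adj V x) = x := by
  rw [starProjection_of_isometry h.adj_V_V h.mem_ker, sub_add_cancel]

theorem proj_adj_add (x : H) : (defectKer (adj A)).starProjection x + W (adj W x) = x := by
  rw [starProjection_of_isometry h.adj_W_W h.mem_ker_adj, sub_add_cancel]

theorem adj_V_proj (x : H) : adj V ((defectKer A).starProjection x) = 0 :=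
  (h.mem_ker _).mp (Submodule.starProjection_apply_mem _ x)

theorem adj_W_proj (x : H) : adj W ((defectKer (adj A)).starProjection x) = 0 :=
  (h.mem_ker_adj _).mp (Submodule.starProjection_apply_mem _ x)

theorem proj_V (u : defectSpace (adj Γ)) : (defectKer A).starProjection (V u) = 0 := by
  rw [starProjection_of_isometry h.adj_V_V h.mem_ker, h.adj_V_V, sub_self]

theorem proj_W (u : defectSpace Γ) : (defectKer (adj A)).starProjection (W u) = 0 := by
  rw [starProjection_of_isometry h.adj_W_W h.mem_ker_adj, h.adj_W_W, sub_self]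

theorem proj_eq_self {x : H} (hx : adj V x = 0) : (defectKer A).starProjection x = x :=
  Submodule.starProjection_eq_self_iff.mpr ((h.mem_ker x).mpr hx)

theorem proj_adj_eq_self {x : H} (hx : adj W x = 0) : (defectKer (adj A)).starProjection x = x :=
  Submodule.starProjection_eq_self_iff.mpr ((h.mem_ker_adj x).mpr hx)

/-- On the dense set of vectors `D_{Γ*} y` this is the off-diagonal relation `B Γ* + A C* = 0`,
rewritten with `D_Γ Γ* = Γ* D_{Γ*}`. -/
theorem A_V (u : defectSpace (adj Γ)) : A (V u) = -W (adjDefect Γ u) := by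
  refine (denseRange_defectCo (adj Γ)).induction_on
    (p := fun u => A (V u) = -W (adjDefect Γ u)) u
    (isClosed_eq (by fun_prop) (by fun_prop)) fun y => ?_
  rw [h.V_defectCo, ← defectCo_adj_apply Γ h.norm_feedthrough, h.W_defectCo]
  have := (((DiscreteSystem.isConservative_iff _).mp h.conservative).2 y 0).2
  simp only [map_zero, add_zero] at this
  exact eq_neg_of_add_eq_zero_right this

theorem adj_A_A_proj (x : H) :
    adj A (A ((defectKer A).starProjection x)) = (defectKer A).starProjection x :=
  (mem_defectKer_iff A h.norm_A _).mp (Submodule.starProjection_apply_mem _ x)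

theorem A_adj_A_proj (x : H) : A (adj A ((defectKer (adj A)).starProjection x)) =
    (defectKer (adj A)).starProjection x := by
  have := (mem_defectKer_iff (adj A) h.norm_adj_A _).mp
    (Submodule.starProjection_apply_mem (defectKer (adj A)) x)
  rwa [adj_adj] at this

/-- `A` respects both decompositions: it maps `ker D_A` into `ker D_{A*}`, and by `A_V` it maps `ran
V`, the complement of the first, into `ran W`, the complement of the second. -/
theorem A_proj (x : H) :
    A ((defectKer A).starProjection x) = (defectKer (adj A)).starProjection (A x) := by
  have h1 : A ((defectKer A).starProjection x) ∈ defectKer (adj A) := by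
    rw [mem_defectKer_iff _ h.norm_adj_A, adj_adj, h.adj_A_A_proj]
  conv_rhs => rw [← h.proj_add x, map_add, h.A_V, map_add, map_neg, h.proj_W, neg_zero, add_zero]
  exact (Submodule.starProjection_eq_self_iff.mpr h1).symm

theorem adj_A_comp_proj : adj (A ∘L (defectKer A).starProjection) =
    (defectKer A).starProjection ∘L adj A := by
  rw [adj_comp]
  congr 1
  exact (isSelfAdjoint_starProjection (defectKer A))

theorem proj_adj_A (x : H) :
    (defectKer A).starProjection (adj A x) = adj A ((defectKer (adj A)).starProjection x) := by
  have h1 : A ∘L (defectKer A).starProjection = (defectKer (adj A)).starProjection ∘L A :=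
    ContinuousLinearMap.ext h.A_proj
  have h2 := h.adj_A_comp_proj
  rw [h1, adj_comp] at h2
  have h3 : adj (defectKer (adj A)).starProjection = (defectKer (adj A)).starProjection :=
    isSelfAdjoint_starProjection _
  rw [h3] at h2
  exact (DFunLike.congr_fun h2 x).symm

/-- The feedback identity linking the state operator of `ν` to `A`. -/
theorem A_proj_eq (x : H) :
    A ((defectKer A).starProjection x) = A x + W (adjDefect Γ (adj V x)) := by
  conv_rhs => rw [← h.proj_add x, map_add, h.A_V]
  simp [h.adj_V_V, h.adj_V_proj]

theorem adj_W_A_proj (x : H) : adj W (A ((defectKer A).starProjection x)) = 0 := by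
  rw [h.A_proj, h.adj_W_proj]

theorem adj_V_adj_A_proj (x : H) : adj V (adj A ((defectKer (adj A)).starProjection x)) = 0 := by
  rw [← h.proj_adj_A, h.adj_V_proj]

end Relations

/-- The system `ν`. -/
abbrev feedbackSystem (A : H →L[ℂ] H) (W : defectSpace Γ →L[ℂ] H)
    (V : defectSpace (adj Γ) →L[ℂ] H) :
    DiscreteSystem (defectSpace Γ) (defectSpace (adj Γ)) H where
  D := 0
  C := adj V
  B := W
  A := A ∘L (defectKer A).starProjection

/-- The system `ζ₁`. -/
abbrev iterateSystem (A : H →L[ℂ] H) (W : defectSpace Γ →L[ℂ] H)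
    (V : defectSpace (adj Γ) →L[ℂ] H) :
    DiscreteSystem (defectSpace Γ) (defectSpace (adj Γ)) (defectKer (adj A)) where
  D := adj V ∘L W
  C := adj V ∘L (defectKer (adj A)).subtypeL
  B := (defectKer (adj A)).orthogonalProjectionOnto ∘L A ∘L W
  A := (defectKer (adj A)).orthogonalProjectionOnto ∘L A ∘L (defectKer (adj A)).subtypeL

/-- The system `ζ₂`. -/
abbrev iterateSystem' (A : H →L[ℂ] H) (W : defectSpace Γ →L[ℂ] H)
    (V : defectSpace (adj Γ) →L[ℂ] H) :
    DiscreteSystem (defectSpace Γ) (defectSpace (adj Γ)) (defectKer A) where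
  D := adj V ∘L W
  C := adj V ∘L A ∘L (defectKer A).subtypeL
  B := (defectKer A).orthogonalProjectionOnto ∘L W
  A := (defectKer A).orthogonalProjectionOnto ∘L A ∘L (defectKer A).subtypeL

/-! ### Conservativity, simplicity and transfer functions of `ν`, `ζ₁`, `ζ₂`. -/

section Systems

variable (h : IsDefectFactorization Γ C B A W V)
include h

/-- The state space splits as `ran V ⊕ ker D_A` on the input side and `ran W ⊕ ker D_{A*}` on the
output side; `V*`, `W` and `A` act unitarily between matching pieces. -/
theorem isConservative_feedbackSystem : (feedbackSystem A W V).IsConservative := by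
  rw [DiscreteSystem.isConservative_iff]
  simp only [h.adj_A_comp_proj, ContinuousLinearMap.comp_apply, ContinuousLinearMap.zero_apply,
    map_zero, map_add, zero_add, adj_adj, h.adj_W_W, h.adj_V_V, h.adj_W_A_proj, h.adj_V_proj,
    h.adj_A_A_proj, h.proj_V, add_zero]
  refine ⟨fun ξ x => ⟨trivial, ?_⟩, fun η x => ⟨trivial, ?_⟩⟩
  · rw [h.proj_adj_A, h.proj_W, map_zero, zero_add, h.proj_eq_self (h.adj_V_proj x), add_comm,
      h.proj_add]
  · rw [h.proj_eq_self (h.adj_V_proj _), h.proj_adj_A, h.A_adj_A_proj, add_comm,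
      h.proj_adj_add]

/-- As long as the orbit stays in `ker V* = ker D_A`, the projection does nothing. With
`pow_adj_feedback` this reduces simplicity of `ν` to that of the given system. -/
theorem pow_feedback {x : H} (hx : ∀ n, adj V (((A ∘L (defectKer A).starProjection) ^ n) x) = 0)
    (n : ℕ) : ((A ∘L (defectKer A).starProjection) ^ n) x = (A ^ n) x := by
  induction n with
  | zero => rfl
  | succ n ih =>
    rw [pow_succ', pow_succ', mul_apply_eq_comp, mul_apply_eq_comp,
      ContinuousLinearMap.comp_apply, h.proj_eq_self (hx n), ih]

theorem pow_adj_feedback {x : H}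
    (hx : ∀ n, adj W ((adj (A ∘L (defectKer A).starProjection) ^ n) x) = 0)
    (n : ℕ) : (adj (A ∘L (defectKer A).starProjection) ^ n) x = (adj A ^ n) x := by
  induction n with
  | zero => rfl
  | succ n ih =>
    rw [pow_succ', pow_succ', mul_apply_eq_comp, mul_apply_eq_comp,
      h.adj_A_comp_proj, ContinuousLinearMap.comp_apply, h.proj_adj_A, ← h.adj_A_comp_proj,
      h.proj_adj_eq_self (hx n), ih]

theorem isSimple_feedbackSystem
    (hs : ({ D := Γ, C := C, B := B, A := A } : DiscreteSystem M N H).IsSimple) :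
    (feedbackSystem A W V).IsSimple := by
  rw [DiscreteSystem.isSimple_iff] at hs ⊢
  intro x h1 h2
  apply hs x
  · intro n
    rw [h.adj_B_eq_zero_iff]
    have := h1 n
    rwa [h.pow_adj_feedback h1] at this
  · intro n
    rw [h.C_eq_zero_iff]
    have := h2 n
    rwa [h.pow_feedback h2] at this

theorem coe_orthogonalProjectionOnto_A (x : H) :
    ((defectKer (adj A)).orthogonalProjectionOnto (A x) : H) =
      A ((defectKer A).starProjection x) := (h.A_proj x).symm

theorem isConservative_iterateSystem : (iterateSystem A W V).IsConservative := by
  have hW : ∀ x : defectKer (adj A), adj W (x : H) = 0 := fun x => (h.mem_ker_adj _).mp x.2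
  have hA : ∀ x : defectKer (adj A), A (adj A (x : H)) = x := fun x => by
    simpa only [adj_adj] using (mem_defectKer_iff (adj A) h.norm_adj_A _).mp x.2
  have hVA : ∀ x : defectKer (adj A), adj V (adj A (x : H)) = 0 := fun x => by
    rw [← h.adj_V_adj_A_proj x, h.proj_adj_eq_self (hW x)]
  have hπW : ∀ u, (defectKer (adj A)).orthogonalProjectionOnto (W u) = 0 := fun u =>
    Subtype.ext (h.proj_W u)
  rw [DiscreteSystem.isConservative_iff]
  simp only [adj_comp, adj_adj, coe_adj_subtype, adj_orthogonalProjectionOnto,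
    ContinuousLinearMap.comp_apply, Submodule.subtypeL_apply, ← map_add]
  constructor
  · intro ξ x
    -- The block operator factors through `H`: first the unitary `(ξ, x) ↦ W ξ + x`, then the
    -- unitary `y ↦ (V* y, A P y)`. This `key` and the next say that the middle step loses nothing.
    have key : V (adj V (W ξ + x)) +
        adj A ((defectKer (adj A)).orthogonalProjectionOnto (A (W ξ + x)) : H) = W ξ + x := by
      rw [h.coe_orthogonalProjectionOnto_A, h.adj_A_A_proj, add_comm, h.proj_add]
    rw [key]
    constructor
    · rw [map_add, h.adj_W_W, hW, add_zero]
    · rw [map_add, hπW, zero_add]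
      simp
  · intro η x
    have key : W (adj W (V η + adj A x)) +
        ((defectKer (adj A)).orthogonalProjectionOnto (V η + adj A x) : H) = V η + adj A x := by
      rw [add_comm]; exact h.proj_adj_add _
    rw [key]
    constructor
    · rw [map_add, h.adj_V_V, hVA, add_zero]
    · rw [map_add, h.A_V, hA, map_add, map_neg, hπW, neg_zero, zero_add]
      simp

theorem isSimple_iterateSystem (hs : (feedbackSystem A W V).IsSimple) :
    (iterateSystem A W V).IsSimple := by
  rw [DiscreteSystem.isSimple_iff] at hs ⊢
  intro x h1 h2
  -- The control operator of `ζ₁` has adjoint `W* A*` on `ker D_{A*}`; its vanishing keeps the next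
  -- adjoint iterate in `ker D_{A*}`, so that the adjoint orbits of `ζ₁` and `ν` agree.
  have h1' : ∀ n, adj W (adj A (((adj (iterateSystem A W V).A) ^ n) x : H)) = 0 := by
    intro n
    have := h1 n
    simp only [adj_comp, adj_orthogonalProjectionOnto] at this ⊢
    exact this
  have p1 : ∀ n, (((iterateSystem A W V).A ^ n) x : H) =
      ((feedbackSystem A W V).A ^ n) (x : H) := by
    intro n
    induction n with
    | zero => rfl
    | succ n ih =>
      rw [pow_succ', pow_succ', mul_apply_eq_comp, mul_apply_eq_comp, ← ih]
      exact h.coe_orthogonalProjectionOnto_A _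
  have p2 : ∀ n, (((adj (iterateSystem A W V).A) ^ n) x : H) =
      ((adj (feedbackSystem A W V).A) ^ n) (x : H) := by
    intro n
    induction n with
    | zero => rfl
    | succ n ih =>
      rw [pow_succ', pow_succ', mul_apply_eq_comp, mul_apply_eq_comp, ← ih]
      have e1 : adj (iterateSystem A W V).A = (defectKer (adj A)).orthogonalProjectionOnto ∘L
          adj A ∘L (defectKer (adj A)).subtypeL := by
        simp only [adj_comp, coe_adj_subtype, adj_orthogonalProjectionOnto,
          ContinuousLinearMap.comp_assoc]
      have e2 : adj (feedbackSystem A W V).A = (defectKer A).starProjection ∘L adj A :=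
        h.adj_A_comp_proj
      set y := (adj (iterateSystem A W V).A ^ n) x with hy
      rw [e1, e2]
      have hy' := h1' n
      have e3 : (defectKer (adj A)).starProjection (y : H) = y :=
        Submodule.starProjection_eq_self_iff.mpr y.2
      change (defectKer (adj A)).starProjection (adj A y) = (defectKer A).starProjection (adj A y)
      rw [h.proj_adj_eq_self hy', h.proj_adj_A, e3]
  apply Subtype.ext
  apply hs
  · intro n
    rw [← p2]
    exact (h.mem_ker_adj _).mp (Subtype.mem _)
  · intro n
    rw [← p1]
    exact h2 n

theorem transfer_feedbackSystem {z : ℂ} (hz : z ∈ Metric.ball (0 : ℂ) 1) :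
    (feedbackSystem A W V).transfer z = z • (iterateSystem A W V).transfer z := by
  ext1 ξ
  obtain ⟨g, hg, ht⟩ := DiscreteSystem.exists_state
    (DiscreteSystem.norm_A_le_one h.isConservative_iterateSystem) hz ξ
  -- A state `g` of `ζ₁` gives the state `W ξ + z g` of `ν`; its output under `V*` is the output of
  -- `ζ₁`, and the extra factor `z` comes from the zero feedthrough of `ν`.
  have hg' : (g : H) = A ((defectKer A).starProjection (W ξ + z • (g : H))) := by
    rw [h.A_proj, map_add, map_add, map_smul, map_smul]
    exact congrArg Subtype.val hg
  have h1 : W ξ + z • (g : H) = (feedbackSystem A W V).B ξ +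
      z • (feedbackSystem A W V).A (W ξ + z • (g : H)) := by
    change _ = W ξ + z • A ((defectKer A).starProjection (W ξ + z • (g : H)))
    rw [← hg']
  rw [DiscreteSystem.transfer_apply_eq
    (DiscreteSystem.norm_A_le_one h.isConservative_feedbackSystem) hz h1,
    smul_apply, ht]
  simp

theorem realization_feedbackSystem {Θ : ℂ → defectSpace Γ →L[ℂ] defectSpace (adj Γ)}
    (hs : ({ D := Γ, C := C, B := B, A := A } : DiscreteSystem M N H).IsSimple)
    (hΘ : ∀ z ∈ Metric.ball (0 : ℂ) 1, Θ z = (iterateSystem A W V).transfer z) :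
    (feedbackSystem A W V).IsSimpleConservativeRealization (fun z => z • Θ z) :=
  ⟨h.isConservative_feedbackSystem, h.isSimple_feedbackSystem hs,
    (DiscreteSystem.hasTransferFunction_iff
      (DiscreteSystem.norm_A_le_one h.isConservative_feedbackSystem)).mpr fun z hz => by
        rw [hΘ z hz, h.transfer_feedbackSystem hz]⟩

theorem realization_iterateSystem {Θ : ℂ → defectSpace Γ →L[ℂ] defectSpace (adj Γ)}
    (hs : ({ D := Γ, C := C, B := B, A := A } : DiscreteSystem M N H).IsSimple)
    (hΘ : ∀ z ∈ Metric.ball (0 : ℂ) 1, Θ z = (iterateSystem A W V).transfer z) :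
    (iterateSystem A W V).IsSimpleConservativeRealization Θ :=
  ⟨h.isConservative_iterateSystem, h.isSimple_iterateSystem (h.isSimple_feedbackSystem hs),
    (DiscreteSystem.hasTransferFunction_iff
      (DiscreteSystem.norm_A_le_one h.isConservative_iterateSystem)).mpr hΘ⟩

theorem realization_iterateSystem' {Θ : ℂ → defectSpace Γ →L[ℂ] defectSpace (adj Γ)}
    (hΘ : (iterateSystem A W V).IsSimpleConservativeRealization Θ) :
    (iterateSystem' A W V).IsSimpleConservativeRealization Θ := by
  have hadj : adj ((defectKer (adj A)).orthogonalProjectionOnto ∘L A ∘L (defectKer A).subtypeL) =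
      (defectKer A).orthogonalProjectionOnto ∘L adj A ∘L (defectKer (adj A)).subtypeL := by
    rw [adj_comp, adj_comp, coe_adj_subtype, adj_orthogonalProjectionOnto,
      ContinuousLinearMap.comp_assoc]
  have hP : ∀ x : defectKer A, (defectKer A).starProjection (x : H) = x := fun x =>
    Submodule.starProjection_eq_self_iff.mpr x.2
  have hP' : ∀ x : defectKer (adj A), (defectKer (adj A)).starProjection (x : H) = x := fun x =>
    Submodule.starProjection_eq_self_iff.mpr x.2
  -- The equivalence is `A` itself, restricted to `ker D_A` and corestricted to `ker D_{A*}`.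
  refine hΘ.of_unitary
    ((defectKer (adj A)).orthogonalProjectionOnto ∘L A ∘L (defectKer A).subtypeL)
    ?_ ?_ rfl ?_ ?_ ?_
  · intro x
    rw [hadj]
    apply Subtype.ext
    change (defectKer A).starProjection (adj A ((defectKer (adj A)).starProjection (A x))) = x
    rw [← h.A_proj, h.adj_A_A_proj, hP, hP]
  · intro x
    rw [hadj]
    apply Subtype.ext
    change (defectKer (adj A)).starProjection (A ((defectKer A).starProjection (adj A x))) = x
    rw [h.proj_adj_A, h.A_adj_A_proj, hP', hP']
  · ext1 x
    change adj V (A x) = adj V ((defectKer (adj A)).starProjection (A x))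
    rw [← h.A_proj, hP]
  · ext1 u
    apply Subtype.ext
    change (defectKer (adj A)).starProjection (A ((defectKer A).starProjection (W u))) =
      (defectKer (adj A)).starProjection (A (W u))
    rw [h.A_proj]
    exact Submodule.starProjection_eq_self_iff.mpr (Submodule.starProjection_apply_mem _ _)
  · ext1 x
    apply Subtype.ext
    change (defectKer (adj A)).starProjection (A ((defectKer A).starProjection (A x))) =
      (defectKer (adj A)).starProjection (A ((defectKer (adj A)).starProjection (A x)))
    rw [← h.A_proj x, hP, h.A_proj]
    exact Submodule.starProjection_eq_self_iff.mpr (Submodule.starProjection_apply_mem _ _)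

end Systems

end IsDefectFactorization

end Factorization

/-! ### Pseudo-inverse products and the Möbius representation. -/

namespace IsDefectFactorization

variable {M N H : Type*}
  [NormedAddCommGroup M] [InnerProductSpace ℂ M] [CompleteSpace M]
  [NormedAddCommGroup N] [InnerProductSpace ℂ N] [CompleteSpace N]
  [NormedAddCommGroup H] [InnerProductSpace ℂ H] [CompleteSpace H]
  {Γ : M →L[ℂ] N} {C : H →L[ℂ] N} {B : M →L[ℂ] H} {A : H →L[ℂ] H}
  {W : defectSpace Γ →L[ℂ] H} {V : defectSpace (adj Γ) →L[ℂ] H}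
  (h : IsDefectFactorization Γ C B A W V)
include h

theorem isPinvComp_C : IsPinvComp (defectOp (adj Γ)) C
    ((defectSpace (adj Γ)).subtypeL ∘L adj V) := by
  refine isPinvComp_of (fun x => ?_) fun x => (h.C_eq x).symm
  exact (defectSpace_eq _).le (adj V x).2

theorem isPinvComp_adj_B : IsPinvComp (defectOp Γ) (adj B)
    ((defectSpace Γ).subtypeL ∘L adj W) := by
  refine isPinvComp_of (fun x => ?_) fun x => (h.adj_B_eq x).symm
  exact (defectSpace_eq _).le (adj W x).2

/-- `D_{A*}` is the transform of `D_Γ` by the partial isometry in the polar decomposition of `B`. -/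
theorem defectOp_adj_eq : defectOp (adj A) =
    (W ∘L (defectSpace Γ).orthogonalProjectionOnto) ∘L defectOp Γ ∘L
      adj (W ∘L (defectSpace Γ).orthogonalProjectionOnto) := by
  set R := W ∘L (defectSpace Γ).orthogonalProjectionOnto with hR
  have hpos : 0 ≤ R ∘L defectOp Γ ∘L adj R :=
    (ContinuousLinearMap.nonneg_iff_isPositive _).mpr
      (((ContinuousLinearMap.nonneg_iff_isPositive _).mp (defectOp_nonneg Γ)).conj_adjoint R)
  refine CFC.sqrt_unique ?_ hpos
  have hadj : adj R = (defectSpace Γ).subtypeL ∘L adj W := by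
    rw [hR, adj_comp, adj_orthogonalProjectionOnto]
  have hRD : ∀ x, R (defectOp Γ x) = B x := by
    intro x
    rw [← h.W_defectCo, hR, ContinuousLinearMap.comp_apply]
    congr 1
    exact Submodule.orthogonalProjectionOnto_mem_subspace_eq_self (defectCo Γ x)
  ext x
  -- The candidate root acts as `B W*`. Since `W* B = D_Γ`, its square is `B D_Γ W* = B B* = 1 - A
  -- A*`.
  have h1 : (adj W (B (adj W x : M)) : M) = defectOp Γ (adj W x) := by
    rw [← h.W_defectCo, h.adj_W_W, coe_defectCo]
  have h2 : ∀ y, (R ∘L defectOp Γ ∘L adj R) y = B (adj W y : M) := by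
    intro y
    simp only [ContinuousLinearMap.comp_apply, hRD]
    rw [hadj]
    rfl
  rw [mul_apply_eq_comp, h2, h2]
  change B (adj W (B (adj W x : M)) : M) = x - adj (adj A) (adj A x)
  rw [h1, ← h.adj_B_eq, adj_adj, eq_sub_iff_add_eq, add_comm]
  exact h.A_adj_A_add x

/-- `D_{A*} W` is `W D_Γ`, and `D_Γ` kills `𝔇_Γᗮ = ker D_Γ`, so projecting to `𝔇_Γ` first changes
nothing. The values lie in `ran W`, which is orthogonal to `ker D_{A*} = ker W*`. -/
theorem isPinvComp_B : IsPinvComp (defectOp (adj A)) B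
    (W ∘L (defectSpace Γ).orthogonalProjectionOnto) := by
  have hadj : adj (W ∘L (defectSpace Γ).orthogonalProjectionOnto) =
      (defectSpace Γ).subtypeL ∘L adj W := by
    rw [adj_comp, adj_orthogonalProjectionOnto]
  have hD : ∀ x : M, defectCo Γ ((defectSpace Γ).starProjection x) = defectCo Γ x := by
    intro x
    rw [← sub_eq_zero, ← map_sub]
    apply Subtype.ext
    have : (defectSpace Γ).starProjection x - x ∈ (defectKer Γ) := by
      have h1 := (defectSpace Γ).sub_starProjection_mem_orthogonal x
      rw [← neg_sub]
      apply Submodule.neg_mem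
      have h2 : (defectSpace Γ)ᗮ = defectKer Γ := by
        rw [defectSpace_eq, Submodule.orthogonal_orthogonal_eq_closure]
        exact IsClosed.submodule_topologicalClosure_eq (defectOp Γ).isClosed_ker
      rwa [h2] at h1
    exact this
  refine isPinvComp_of (fun x => ?_) fun x => ?_
  · intro y hy
    have h1 : adj W y = 0 := (h.mem_ker_adj y).mp hy
    rw [ContinuousLinearMap.comp_apply, ← ContinuousLinearMap.adjoint_inner_left, h1,
      inner_zero_left]
  · rw [h.defectOp_adj_eq, hadj]
    simp only [ContinuousLinearMap.comp_apply, h.adj_W_W, Submodule.subtypeL_apply]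
    rw [← h.W_defectCo x, ← hD x]
    congr 1
    exact Submodule.orthogonalProjectionOnto_mem_subspace_eq_self
      (defectCo Γ ((defectSpace Γ).starProjection x))

theorem isUnit_one_add_transfer {z : ℂ} (hz : z ∈ Metric.ball (0 : ℂ) 1) :
    IsUnit (1 + adjDefect Γ ∘L (feedbackSystem A W V).transfer z) := by
  have hu := isUnit_one_sub_smul h.norm_A hz
  have hn := DiscreteSystem.norm_A_le_one h.isConservative_feedbackSystem
  -- The inverse is the transfer function of the inverse system: closing the loop turns the state
  -- operator `A P` into `A`, whose resolvent exists on the disk.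
  set S : defectSpace Γ →L[ℂ] defectSpace Γ :=
    1 - z • (adjDefect Γ ∘L adj V ∘L Ring.inverse (1 - z • A) ∘L W) with hS
  refine ⟨⟨_, S, ?_, ?_⟩, rfl⟩
  · ext1 v
    set f := Ring.inverse (1 - z • A) (W v) with hf
    have hf' : f = W v + z • A f := by
      apply sub_eq_iff_eq_add.mp
      simpa using apply_inverse hu (W v)
    have hSv : S v = v - z • adjDefect Γ (adj V f) := rfl
    -- The same `f` is a state of `ν` for the input `S v`; the feedback term of `A_proj_eq` absorbs
    -- the difference.
    have h1 : f = (feedbackSystem A W V).B (S v) + z • (feedbackSystem A W V).A f := by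
      change f = W (S v) + z • A ((defectKer A).starProjection f)
      rw [h.A_proj_eq, hSv, map_sub, map_smul, smul_add]
      conv_lhs => rw [hf']
      abel
    have h2 := DiscreteSystem.transfer_apply_eq hn hz h1
    change S v + adjDefect Γ ((feedbackSystem A W V).transfer z (S v)) = v
    rw [h2, hSv]
    simp
  · ext1 u
    obtain ⟨f, hf, ht⟩ := DiscreteSystem.exists_state hn hz u
    have ht' : (feedbackSystem A W V).transfer z u = z • adj V f := by
      rw [ht]; simp
    have hf' : f = W (u + adjDefect Γ ((feedbackSystem A W V).transfer z u)) + z • A f := by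
      have h1 : f = W u + z • A ((defectKer A).starProjection f) := hf
      rw [h.A_proj_eq] at h1
      rw [ht', map_add, map_smul, map_smul]
      conv_lhs => rw [h1]
      rw [smul_add]
      abel
    have h2 : Ring.inverse (1 - z • A)
        (W (u + adjDefect Γ ((feedbackSystem A W V).transfer z u))) = f := by
      apply inverse_apply_eq hu
      simpa using sub_eq_iff_eq_add.mpr hf'
    change (u + adjDefect Γ ((feedbackSystem A W V).transfer z u)) - z • adjDefect Γ (adj V
      (Ring.inverse (1 - z • A) (W (u + adjDefect Γ ((feedbackSystem A W V).transfer z u))))) = u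
    rw [h2, ht', map_smul]
    abel

theorem transfer_eq_moebius {z : ℂ} (hz : z ∈ Metric.ball (0 : ℂ) 1) :
    ({ D := Γ, C := C, B := B, A := A } : DiscreteSystem M N H).transfer z =
      Γ + defectOp (adj Γ) ∘L (defectSpace (adj Γ)).subtypeL ∘L
        (feedbackSystem A W V).transfer z ∘L
        Ring.inverse (1 + adjDefect Γ ∘L (feedbackSystem A W V).transfer z) ∘L defectCo Γ := by
  have hn := DiscreteSystem.norm_A_le_one h.isConservative_feedbackSystem
  ext1 ξ
  set Z := (feedbackSystem A W V).transfer z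
  set u := Ring.inverse (1 + adjDefect Γ ∘L Z) (defectCo Γ ξ) with hu
  have hu' : u + adjDefect Γ (Z u) = defectCo Γ ξ :=
    apply_inverse (h.isUnit_one_add_transfer hz) (defectCo Γ ξ)
  obtain ⟨f, hf, ht⟩ := DiscreteSystem.exists_state hn hz u
  have ht' : Z u = z • adj V f := by
    rw [show Z u = _ from ht]; simp
  -- As `u + Γ* Z u = D_Γ ξ`, the state of `ν` for the input `u` is the state of the original system
  -- for `ξ`.
  have hf' : f = B ξ + z • A f := by
    have h1 : f = W u + z • A ((defectKer A).starProjection f) := hf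
    rw [h.A_proj_eq] at h1
    rw [← h.W_defectCo, ← hu', ht', map_add, map_smul, map_smul]
    conv_lhs => rw [h1]
    rw [smul_add]
    abel
  rw [DiscreteSystem.transfer_apply_eq (τ := ⟨Γ, C, B, A⟩) h.norm_A hz hf']
  change Γ ξ + z • C f = Γ ξ + defectOp (adj Γ) (Z u : N)
  rw [ht', h.C_eq, Submodule.coe_smul, map_smul]

end IsDefectFactorization

theorem isFirstSchurIterate_transfer {M N H : Type*}
    [NormedAddCommGroup M] [InnerProductSpace ℂ M] [CompleteSpace M]
    [NormedAddCommGroup N] [InnerProductSpace ℂ N] [CompleteSpace N]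
    [NormedAddCommGroup H] [InnerProductSpace ℂ H] [CompleteSpace H]
    {Θ : ℂ → M →L[ℂ] N} {C : H →L[ℂ] N} {B : M →L[ℂ] H} {A : H →L[ℂ] H}
    {W : defectSpace (Θ 0) →L[ℂ] H} {V : defectSpace (adj (Θ 0)) →L[ℂ] H}
    (h : IsDefectFactorization (Θ 0) C B A W V)
    (hΘ : ({ D := Θ 0, C := C, B := B, A := A } :
      DiscreteSystem M N H).HasTransferFunction Θ) :
    IsFirstSchurIterate Θ (IsDefectFactorization.iterateSystem A W V).transfer := by
  have hs := DiscreteSystem.isSchurClass_transfer h.isConservative_iterateSystem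
  refine ⟨hs, (IsDefectFactorization.feedbackSystem A W V).transfer,
    ⟨DiscreteSystem.isSchurClass_transfer h.isConservative_feedbackSystem,
      fun z hz => h.isUnit_one_add_transfer hz, fun z hz => ?_⟩,
    fun z hz => h.transfer_feedbackSystem hz⟩
  rw [← h.transfer_eq_moebius hz]
  exact (DiscreteSystem.hasTransferFunction_iff (τ := ⟨Θ 0, C, B, A⟩) h.norm_A).mp hΘ z hz

end SchurRealization

end

/-! ### Assembly of the theorem. -/

open SchurRealization in
theorem mainTheorem5 {M N H : Type*}
    [NormedAddCommGroup M] [InnerProductSpace ℂ M] [CompleteSpace M]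
    [NormedAddCommGroup N] [InnerProductSpace ℂ N] [CompleteSpace N]
    [NormedAddCommGroup H] [InnerProductSpace ℂ H] [CompleteSpace H]
    (Θ : ℂ → M →L[ℂ] N) (hΘ : IsSchurClass Θ)
    (C : H →L[ℂ] N) (B : M →L[ℂ] H) (A : H →L[ℂ] H)
    (hτ : DiscreteSystem.IsSimpleConservativeRealization
      ({ D := Θ 0, C := C, B := B, A := A } : DiscreteSystem M N H) Θ) :
    -- the first Schur iterate exists
    (∃ Θ₁ : ℂ → defectSpace (Θ 0) →L[ℂ] defectSpace (adj (Θ 0)), IsFirstSchurIterate Θ Θ₁) ∧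
    -- the pseudo-inverse products are everywhere defined bounded operators
    ∃ (G : H →L[ℂ] defectSpace (adj (Θ 0))) (R : M →L[ℂ] H) (K : H →L[ℂ] defectSpace (Θ 0))
      (B₁ : defectSpace (Θ 0) →L[ℂ] defectKer (adj A)),
      IsPinvComp (defectOp (adj (Θ 0))) C ((defectSpace (adj (Θ 0))).subtypeL ∘L G) ∧
      IsPinvComp (defectOp (adj A)) B R ∧
      IsPinvComp (defectOp (Θ 0)) (adj B) ((defectSpace (Θ 0)).subtypeL ∘L K) ∧
      (∀ x : defectSpace (Θ 0), (B₁ x : H) = A ((defectKer A).starProjection (R x))) ∧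
      ∀ Θ₁ : ℂ → defectSpace (Θ 0) →L[ℂ] defectSpace (adj (Θ 0)), IsFirstSchurIterate Θ Θ₁ →
        -- the system `ν`
        DiscreteSystem.IsSimpleConservativeRealization
          ({ D := 0
             C := G
             B := R ∘L (defectSpace (Θ 0)).subtypeL
             A := A ∘L (defectKer A).starProjection } :
            DiscreteSystem (defectSpace (Θ 0)) (defectSpace (adj (Θ 0))) H)
          (fun z => z • Θ₁ z) ∧
        -- the system `ζ₁`
        DiscreteSystem.IsSimpleConservativeRealization
          ({ D := G ∘L adj K
             C := G ∘L (defectKer (adj A)).subtypeL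
             B := B₁
             A := (defectKer (adj A)).orthogonalProjectionOnto ∘L A ∘L
               (defectKer (adj A)).subtypeL } :
            DiscreteSystem (defectSpace (Θ 0)) (defectSpace (adj (Θ 0))) (defectKer (adj A)))
          Θ₁ ∧
        -- the system `ζ₂`
        DiscreteSystem.IsSimpleConservativeRealization
          ({ D := G ∘L adj K
             C := G ∘L A ∘L (defectKer A).subtypeL
             B := (defectKer A).orthogonalProjectionOnto ∘L R ∘L (defectSpace (Θ 0)).subtypeL
             A := (defectKer A).orthogonalProjectionOnto ∘L A ∘L (defectKer A).subtypeL } :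
            DiscreteSystem (defectSpace (Θ 0)) (defectSpace (adj (Θ 0))) (defectKer A))
          Θ₁ := by
  obtain ⟨W, V, h⟩ := exists_isDefectFactorization hτ.conservative
  have hit := isFirstSchurIterate_transfer h hτ.transfer
  have hR : ∀ x : defectSpace (Θ 0), (defectSpace (Θ 0)).orthogonalProjectionOnto (x : M) = x :=
    Submodule.orthogonalProjectionOnto_mem_subspace_eq_self
  refine ⟨⟨_, hit⟩, adj V, W ∘L (defectSpace (Θ 0)).orthogonalProjectionOnto, adj W,
    (defectKer (adj A)).orthogonalProjectionOnto ∘L A ∘L W,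
    h.isPinvComp_C, h.isPinvComp_B, h.isPinvComp_adj_B, ?_, ?_⟩
  · intro x
    simp only [ContinuousLinearMap.comp_apply, hR]
    exact h.coe_orthogonalProjectionOnto_A _
  · intro Θ₁ hΘ₁
    -- By uniqueness any first Schur iterate agrees on the disk with the transfer function of `ζ₁`.
    have heq := hΘ₁.eqOn hit
    have hRW : (W ∘L (defectSpace (Θ 0)).orthogonalProjectionOnto) ∘L
        (defectSpace (Θ 0)).subtypeL = W :=
      ContinuousLinearMap.ext fun x => congrArg W (hR x)
    rw [hRW, adj_adj]
    have h1 := h.realization_iterateSystem hτ.simple heq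
    exact ⟨h.realization_feedbackSystem hτ.simple heq, h1, h.realization_iterateSystem' h1⟩
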